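/- **Framework.** A finite two-player zero-sum stochastic game has a finite set $S$ of states, finite nonempty action sets $A^s,B^s$, payments $r^s(a,b)$ from player two to player one, and laws $P_{s,a,b}$ of the next state. In every step both players choose their actions simultaneously and independently. Behaviour strategies $\pi,\varphi$ assign to every history $(s_0,a_0,b_0,\dots,s)$ a probability on $A^s$, respectively $B^s$. They are *pure* if these probabilities are point masses, and *stationary* if they depend only on the last state $s$. Put $V_{\pi,\varphi}(s)=\sum_{t\ge0}\mathbf E_{s,\pi,\varphi}\,r^{S_t}(A_t,B_t)$. A strategy $\pi^*$ is optimal if $\inf_\varphi V_{\pi^*,\varphi}(s)=\sup_\pi\inf_\varphi V_{\pi,\varphi}(s)$ for all $s$, and $\varphi^*$ is optimal if $\sup_\pi V_{\pi,\varphi^*}(s)=\inf_\varphi\sup_\pi V_{\pi,\varphi}(s)$ for all $s$. The game is *transient* with final state $s_f$ if $s_f$ is absorbing, payments in $s_f$ are $0$, and $\sum_t\mathbf P_{s,\pi,\varphi}(S_t\ne s_f)<\infty$ for all $s,\pi,\varphi$. Let $M_x^s=\bigl[r^s(a,b)+\sum_{s'}P_{s,a,b}(s')x(s')\bigr]_{a\in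 A^s,b\in B^s}$ and let $Ux(s)$ be the value of the matrix game $M_x^s$ in mixed actions. **The dice games.** The states are $s_i$ (initial), $s_f$ (final) and $(j,\alpha,\beta,\tau)$, where player $j\in\{1,2\}$ has the die, $\alpha,\beta\in\{0,\dots,199\}$ are the banked scores and $\tau\ge0$ is the turn score. Write $\sigma$ for the total of player $j$, i.e. $\sigma=\alpha+\tau$ if $j=1$ and $\sigma=\beta+\tau$ if $j=2$; states have $\sigma\le205$. The player without the die waits, and both wait in $s_i,s_f$. The player with the die must roll if $\tau=0$, must stop if $\sigma\ge200$, and otherwise may roll or stop. A roll uses a fair die: with an ace the turn score is lost and the die passes to the opponent (whose turn score is $0$); with $k\in\{2,\dots,6\}$, $\tau$ becomes $\tau+k$. Stopping with $\sigma<200$ adds $\tau$ to the player's score and passes the die; stopping with $\sigma\ge200$ leads to $s_f$. From $s_i$ the next state is $(1,0,0,0)$ or $(2,0,0,0)$, each with probability $1/2$; $s_f$ is absorbing. Consider: 1. *Classical game*: the payment is $1$ in states with $j=1$, $\alpha+\tau\ge200$, and $0$ elsewhere. 2. *Expected difference*: the same, except that the payment is $200-\beta$ in states with $j=1$, $\alpha+\tau\ge200$;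 $\alpha-200$ in states with $j=2$, $\beta+\tau\ge200$; and $0$ elsewhere. 3. *Reaching exactly 200*: as the classical game, but states have $\sigma\le200$, and a roll that would make $\sigma>200$ loses the turn (the turn score is lost and the die passes). 4. *Reaching exactly 200, without banking 199*: as 3, but banked scores are at most $198$ and stopping is not available when $\sigma=199$ (a player with $199$ banked points can never reach exactly $200$). **Theorem.** (a) Each of the games 1, 2, 4 is transient with final state $s_f$. More precisely, with $\gamma=6^{-70}$, for all $\pi,\varphi$ and every history, the conditional probability given that history that the state $140$ steps later is $s_f$ is at least $\gamma$; and $\mathbf P_{s,\pi,\varphi}(S_t\neq s_f)\le(1-\gamma)^{\lfloor t/140\rfloor}$ for all $s,\pi,\varphi,t$. The series defining $V_{\pi,\varphi}(s)$ converges absolutely. There is a function $v:S\to\mathbb R$ with $$\sup_\pi\inf_\varphi V_{\pi,\varphi}(s)=v(s)=\inf_\varphi\sup_\pi V_{\pi,\varphi}(s)\qquad\text{for all }s\in S,$$ and $v$ is the unique fixed point of $U$ among the functions $x:S\to\mathbb R$ with $x(s_f)=0$. Every stationary strategy, of either player, whose mixed action in each state $s$ is optimal in the matrix game $M_v^s$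 is optimal. Each player has an optimal strategy that is both pure and stationary. (b) In game 3 the series defining $V_{\pi,\varphi}(s)$ converges absolutely for all $\pi,\varphi,s$, there is $v:S\to\mathbb R$ with $\sup_\pi\inf_\varphi V_{\pi,\varphi}(s)=v(s)=\inf_\varphi\sup_\pi V_{\pi,\varphi}(s)$ for all $s$, $Uv=v$, and each player has an optimal strategy that is both pure and stationary. -/

import Mathlib

open scoped ENNReal

/-! ### Finite two-player zero-sum stochastic games -/

/-- A two-player zero-sum stochastic game with finitely many states and actions: states `S`,
nonempty finite action sets `A s`, `B s`, the amount `r s a b` that player two pays to player one,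
and the law `P s a b` of the next state. -/
structure StochasticGame where
  S : Type
  A : S → Type
  B : S → Type
  [fintypeS : Fintype S]
  [fintypeA : ∀ s, Fintype (A s)]
  [fintypeB : ∀ s, Fintype (B s)]
  [nonemptyA : ∀ s, Nonempty (A s)]
  [nonemptyB : ∀ s, Nonempty (B s)]
  r : (s : S) → A s → B s → ℝ
  P : (s : S) → A s → B s → PMF S

attribute [instance] StochasticGame.fintypeS StochasticGame.fintypeA StochasticGame.fintypeB
  StochasticGame.nonemptyA StochasticGame.nonemptyB

namespace StochasticGame

variable (G : StochasticGame)

/-- Triples `(s, a, b)` with `a` and `b` admissible in `s`. -/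
abbrev K : Type := Σ s : G.S, G.A s × G.B s

/-- Admissible histories `(s₀, a₀, b₀, …, s)` of any length: the list, in chronological order, of
the past triples, and the current state. -/
abbrev History : Type := List G.K × G.S

/-- Behaviour strategies of player one. -/
abbrev Strategy₁ : Type := (h : G.History) → PMF (G.A h.2)

/-- Behaviour strategies of player two. -/
abbrev Strategy₂ : Type := (h : G.History) → PMF (G.B h.2)

variable {G}

/-- A strategy of player one is pure if after each history some action has probability one. -/
def IsPure₁ (π : G.Strategy₁) : Prop := ∀ h, ∃ a, π h a = 1

/-- A strategy of player two is pure if after each history some action has probability one. -/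
def IsPure₂ (φ : G.Strategy₂) : Prop := ∀ h, ∃ b, φ h b = 1

/-- The strategy of player one that uses the mixed action `σ s` whenever the current state is `s`. -/
def stationary₁ (σ : (s : G.S) → PMF (G.A s)) : G.Strategy₁ := fun h => σ h.2

/-- The strategy of player two that uses the mixed action `σ s` whenever the current state is `s`. -/
def stationary₂ (σ : (s : G.S) → PMF (G.B s)) : G.Strategy₂ := fun h => σ h.2

/-- A strategy of player one is stationary if it depends only on the current state. -/
def IsStationary₁ (π : G.Strategy₁) : Prop := ∃ σ, π = stationary₁ σ

/-- A strategy of player two is stationary if it depends only on the current state. -/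
def IsStationary₂ (φ : G.Strategy₂) : Prop := ∃ σ, φ = stationary₂ σ

/-- The law of `(S_t, A_t, B_t)` given that the history up to time `t` is `h`: the players choose
their actions independently of each other. -/
noncomputable def actionLaw (π : G.Strategy₁) (φ : G.Strategy₂) (h : G.History) : PMF G.K :=
  (π h).bind fun a => (φ h).map fun b => ⟨h.2, a, b⟩

/-- The law of the history up to time `t + 1` given that the history up to time `t` is `h`. -/
noncomputable def stepLaw (π : G.Strategy₁) (φ : G.Strategy₂) (h : G.History) : PMF G.History :=
  (actionLaw π φ h).bind fun k => (G.P k.1 k.2.1 k.2.2).map fun s' => (h.1 ++ [k], s')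

/-- The law of the history `n` steps later, given that the history so far is `h`. -/
noncomputable def historyLawFrom (π : G.Strategy₁) (φ : G.Strategy₂) (h : G.History) :
    ℕ → PMF G.History
  | 0 => PMF.pure h
  | n + 1 => (historyLawFrom π φ h n).bind (stepLaw π φ)

/-- The law of the state `n` steps later, given that the history so far is `h`. -/
noncomputable def stateLawFrom (π : G.Strategy₁) (φ : G.Strategy₂) (h : G.History) (n : ℕ) :
    PMF G.S :=
  (historyLawFrom π φ h n).map Prod.snd

/-- The law of `S_t` under `P_{s,π,φ}`. -/
noncomputable def stateLaw (π : G.Strategy₁) (φ : G.Strategy₂) (s : G.S) (t : ℕ) : PMF G.S :=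
  stateLawFrom π φ ([], s) t

/-- The law of `(S_t, A_t, B_t)` under `P_{s,π,φ}`. -/
noncomputable def tripleLaw (π : G.Strategy₁) (φ : G.Strategy₂) (s : G.S) (t : ℕ) : PMF G.K :=
  (historyLawFrom π φ ([], s) t).bind (actionLaw π φ)

/-- The probability `P_{s,π,φ}(S_t ≠ s_f)`. -/
noncomputable def probNe (π : G.Strategy₁) (φ : G.Strategy₂) (s : G.S) (t : ℕ) (sf : G.S) : ℝ≥0∞ :=
  (stateLaw π φ s t).toOuterMeasure {sf}ᶜ

/-- The expected payment `E_{s,π,φ} r^{S_t}(A_t, B_t)` at time `t`. -/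
noncomputable def expectedPay (π : G.Strategy₁) (φ : G.Strategy₂) (s : G.S) (t : ℕ) : ℝ :=
  ∑ k : G.K, (tripleLaw π φ s t k).toReal * G.r k.1 k.2.1 k.2.2

/-- The value `V_{π,φ}(s)` of a pair of strategies. -/
noncomputable def V (π : G.Strategy₁) (φ : G.Strategy₂) (s : G.S) : ℝ :=
  ∑' t, expectedPay π φ s t

variable (G)

/-- `G` is transient with final state `sf`. -/
def IsTransientWith (sf : G.S) : Prop :=
  (∀ a b, G.r sf a b = 0) ∧
  (∀ a b, G.P sf a b sf = 1) ∧
  ∀ (π : G.Strategy₁) (φ : G.Strategy₂) (s : G.S), ∑' t, probNe π φ s t sf < ⊤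

/-- `sup_π inf_φ V_{π,φ}(s)`, in the extended reals. -/
noncomputable def lowerValue (s : G.S) : EReal :=
  ⨆ π : G.Strategy₁, ⨅ φ : G.Strategy₂, (V π φ s : EReal)

/-- `inf_φ sup_π V_{π,φ}(s)`, in the extended reals. -/
noncomputable def upperValue (s : G.S) : EReal :=
  ⨅ φ : G.Strategy₂, ⨆ π : G.Strategy₁, (V π φ s : EReal)

variable {G}

/-- Optimality of a strategy of player one (from all initial states). -/
def IsOptimal₁ (π : G.Strategy₁) : Prop :=
  ∀ s, ⨅ φ : G.Strategy₂, (V π φ s : EReal) = G.lowerValue s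

/-- Optimality of a strategy of player two (from all initial states). -/
def IsOptimal₂ (φ : G.Strategy₂) : Prop :=
  ∀ s, ⨆ π : G.Strategy₁, (V π φ s : EReal) = G.upperValue s

end StochasticGame

/-! ### Matrix games and the Shapley operator -/

/-- Expected payoff of the mixed actions `p` (rows) and `q` (columns) in the matrix game `M`. -/
noncomputable def matrixPay {X Y : Type} [Fintype X] [Fintype Y] (M : X → Y → ℝ)
    (p : PMF X) (q : PMF Y) : ℝ :=
  ∑ a, ∑ b, (p a).toReal * (q b).toReal * M a b

/-- The value of the matrix game `M` in mixed actions; the row player maximises. -/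
noncomputable def matrixValue {X Y : Type} [Fintype X] [Fintype Y] (M : X → Y → ℝ) : ℝ :=
  ⨆ p : PMF X, ⨅ q : PMF Y, matrixPay M p q

namespace StochasticGame

variable (G : StochasticGame)

/-- The matrix `r^s(a,b) + ∑_{s'} P_{s,a,b}(s') x(s')`. -/
noncomputable def auxMatrix (x : G.S → ℝ) (s : G.S) (a : G.A s) (b : G.B s) : ℝ :=
  G.r s a b + ∑ s', (G.P s a b s').toReal * x s'

/-- The Shapley (Bellman) operator `U`. -/
noncomputable def U (x : G.S → ℝ) (s : G.S) : ℝ := matrixValue (G.auxMatrix x s)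

end StochasticGame

/-! ### The dice games -/

/-- The versions of the dice game: the classical one; the one where exactly 200 points are needed;
the same without the possibility of banking a score of 199, from which 200 is out of reach;
and the one where the winner receives the difference between the target and the loser's score. -/
inductive DiceVariant
  | classic
  | exact
  | exactNo199
  | difference
  deriving DecidableEq

inductive Player
  | one
  | two
  deriving DecidableEq

instance : Fintype Player := ⟨{.one, .two}, fun j => by cases j <;> simp⟩

instance : Nonempty Player := ⟨.one⟩

/-- To roll, to stop and bank the turn score (`hold`), or to wait (during the opponent's turn). -/
inductive Move
  | roll
  | hold
  | wait
  deriving DecidableEq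

instance : Fintype Move := ⟨{.roll, .hold, .wait}, fun m => by cases m <;> simp⟩

/-- A tuple `(j, α, β, τ)`: the player who has the die, the accumulated scores of players one and
two, and the turn score. -/
structure Turn where
  j : Player
  α : ℕ
  β : ℕ
  τ : ℕ
  deriving DecidableEq

namespace Turn

/-- Accumulated score plus turn score of the player who has the die. -/
def total (x : Turn) : ℕ :=
  match x.j with
  | .one => x.α + x.τ
  | .two => x.β + x.τ

/-- The die goes to the opponent and the turn score is lost. -/
def pass (x : Turn) : Turn :=
  match x.j with
  | .one => ⟨.two, x.α, x.β, 0⟩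
  | .two => ⟨.one, x.α, x.β, 0⟩

/-- The turn score is banked and the die goes to the opponent. -/
def bank (x : Turn) : Turn :=
  match x.j with
  | .one => ⟨.two, x.α + x.τ, x.β, 0⟩
  | .two => ⟨.one, x.α, x.β + x.τ, 0⟩

/-- The turn score grows by `d`. -/
def add (x : Turn) (d : ℕ) : Turn := ⟨x.j, x.α, x.β, x.τ + d⟩

end Turn

namespace DiceVariant

/-- The largest accumulated score that a player can have in a running game. -/
def maxScore : DiceVariant → ℕ
  | exactNo199 => 198
  | _ => 199

/-- The largest possible sum of accumulated score and turn score. -/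
def maxTotal : DiceVariant → ℕ
  | classic | difference => 205
  | exact | exactNo199 => 200

/-- The tuples that are states. -/
def Valid (v : DiceVariant) (x : Turn) : Prop :=
  x.α ≤ v.maxScore ∧ x.β ≤ v.maxScore ∧ x.total ≤ v.maxTotal

/-- The moves (other than waiting) available to the player who has the die. A roll is available
as long as stopping does not win, a stop at any time but the beginning of a turn. -/
def Legal (v : DiceVariant) (x : Turn) : Move → Prop
  | .roll => x.total < 200
  | .hold => 0 < x.τ ∧ (v = exactNo199 → x.total ≠ 199)
  | .wait => False

end DiceVariant

/-- The states: an initial state, a final state, and the tuples `(j, α, β, τ)`. -/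
inductive DiceState (v : DiceVariant)
  | start
  | final
  | turn (x : Turn) (hx : v.Valid x)

namespace DiceState

variable {v : DiceVariant}

instance : Finite (DiceState v) := by
  let f : DiceState v → Option (Option (Player × Fin 206 × Fin 206 × Fin 206)) := fun s =>
    match s with
    | .start => none
    | .final => some none
    | .turn x _ => some (some (x.j, Fin.ofNat 206 x.α, Fin.ofNat 206 x.β, Fin.ofNat 206 x.τ))
  have bd : ∀ x : Turn, v.Valid x → x.α < 206 ∧ x.β < 206 ∧ x.τ < 206 := by
    rintro ⟨j, α, β, τ⟩ ⟨h1, h2, h3⟩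
    cases v <;> cases j <;>
      simp only [DiceVariant.maxScore, DiceVariant.maxTotal, Turn.total] at h1 h2 h3 ⊢ <;> omega
  refine Finite.of_injective f ?_
  intro s s' h
  cases s with
  | start => cases s' <;> simp [f] at h ⊢
  | final => cases s' <;> simp [f] at h ⊢
  | turn x hx =>
    cases s' with
    | start => simp [f] at h
    | final => simp [f] at h
    | turn y hy =>
      obtain ⟨a1, a2, a3⟩ := bd x hx
      obtain ⟨b1, b2, b3⟩ := bd y hy
      obtain ⟨j, α, β, τ⟩ := x
      obtain ⟨j', α', β', τ'⟩ := y
      simp only [f, Option.some.injEq, Prod.mk.injEq, Fin.ext_iff, Fin.ofNat] at h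
      simp only [DiceState.turn.injEq, Turn.mk.injEq]
      simp only at a1 a2 a3 b1 b2 b3
      rw [Nat.mod_eq_of_lt a1, Nat.mod_eq_of_lt a2, Nat.mod_eq_of_lt a3, Nat.mod_eq_of_lt b1,
        Nat.mod_eq_of_lt b2, Nat.mod_eq_of_lt b3] at h
      exact h

noncomputable instance : Fintype (DiceState v) := Fintype.ofFinite _

/-- The moves available to player `i` in a state. -/
def Allowed (i : Player) : DiceState v → Move → Prop
  | .start, m => m = .wait
  | .final, m => m = .wait
  | .turn x _, m => if x.j = i then v.Legal x m else m = .wait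

theorem exists_allowed (i : Player) (s : DiceState v) : ∃ m, s.Allowed i m := by
  cases s with
  | start => exact ⟨.wait, rfl⟩
  | final => exact ⟨.wait, rfl⟩
  | turn x hx =>
    by_cases hj : x.j = i
    · by_cases h : x.total < 200
      · exact ⟨.roll, by simpa [Allowed, hj, DiceVariant.Legal] using h⟩
      · refine ⟨.hold, ?_⟩
        simp only [Allowed, hj, if_true, DiceVariant.Legal]
        obtain ⟨j, α, β, τ⟩ := x
        obtain ⟨h1, h2, h3⟩ := hx
        cases v <;> cases j <;>
          simp only [DiceVariant.maxScore, DiceVariant.maxTotal, Turn.total] at h h1 h2 h3 ⊢ <;>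
          exact ⟨by omega, by intro; omega⟩
    · exact ⟨.wait, by simp [Allowed, hj]⟩

/-- The action set of player `i` in the state `s`. -/
abbrev Action (i : Player) (s : DiceState v) : Type := {m : Move // s.Allowed i m}

noncomputable instance (i : Player) (s : DiceState v) : Fintype (s.Action i) := Fintype.ofFinite _

instance (i : Player) (s : DiceState v) : Nonempty (s.Action i) :=
  let ⟨m, hm⟩ := s.exists_allowed i
  ⟨⟨m, hm⟩⟩

theorem valid_pass {x : Turn} (hx : v.Valid x) : v.Valid x.pass := by
  obtain ⟨j, α, β, τ⟩ := x
  obtain ⟨h1, h2, h3⟩ := hx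
  cases v <;> cases j <;>
    simp only [DiceVariant.Valid, DiceVariant.maxScore, DiceVariant.maxTotal, Turn.total,
      Turn.pass] at h1 h2 h3 ⊢ <;> omega

theorem valid_add {x : Turn} (hx : v.Valid x) {d : ℕ} (hd : x.total + d ≤ v.maxTotal) :
    v.Valid (x.add d) := by
  obtain ⟨j, α, β, τ⟩ := x
  obtain ⟨h1, h2, h3⟩ := hx
  cases v <;> cases j <;>
    simp only [DiceVariant.Valid, DiceVariant.maxScore, DiceVariant.maxTotal, Turn.total,
      Turn.add] at hd h1 h2 h3 ⊢ <;> omega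

theorem valid_bank {x : Turn} (hx : v.Valid x) (h : x.total < 200) (hs : v.Legal x .hold) :
    v.Valid x.bank := by
  obtain ⟨j, α, β, τ⟩ := x
  obtain ⟨h1, h2, h3⟩ := hx
  obtain ⟨hs1, hs2⟩ := hs
  cases v <;> cases j <;>
    simp [DiceVariant.Valid, DiceVariant.maxScore, DiceVariant.maxTotal, Turn.total,
      Turn.bank] at h hs1 hs2 h1 h2 h3 ⊢ <;> omega

theorem valid_zero (j : Player) : v.Valid ⟨j, 0, 0, 0⟩ := by
  cases j <;> simp [DiceVariant.Valid, Turn.total]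

/-- The state after the die has shown `d + 1`. The turn is lost with an ace and, when exactly
200 points are needed, if the total would exceed 200. In the other versions a total above
`v.maxTotal = 205` cannot occur, since a roll is only made with a total below 200. -/
def afterRoll (x : Turn) (hx : v.Valid x) (d : Fin 6) : DiceState v :=
  if h : d = 0 ∨ v.maxTotal < x.total + (d + 1) then .turn x.pass (valid_pass hx)
  else .turn (x.add (d + 1)) (valid_add hx (by omega))

/-- The state after a stop: the game is over if the total has reached 200; otherwise the turn
score is banked. -/
def afterStop (x : Turn) (hx : v.Valid x) (hs : v.Legal x .hold) : DiceState v :=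
  if h : x.total < 200 then .turn x.bank (valid_bank hx h hs) else .final

/-- The law of the next state when the player who has the die makes the move `m`. -/
noncomputable def moveLaw (x : Turn) (hx : v.Valid x) :
    (m : Move) → v.Legal x m → PMF (DiceState v)
  | .roll, _ => (PMF.uniformOfFintype (Fin 6)).map (afterRoll x hx)
  | .hold, hs => PMF.pure (afterStop x hx hs)
  | .wait, hw => hw.elim

theorem legal_of_allowed {x : Turn} {hx : v.Valid x} {i : Player} {m : Move}
    (hj : x.j = i) (hm : (DiceState.turn x hx).Allowed i m) : v.Legal x m := by
  simpa [Allowed, hj] using hm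

theorem eq_two_of_ne_one {j : Player} (h : j ≠ .one) : j = .two := by
  cases j
  · exact absurd rfl h
  · rfl

/-- The transition probabilities. -/
noncomputable def transition :
    (s : DiceState v) → s.Action .one → s.Action .two → PMF (DiceState v)
  | .start, _, _ =>
      (PMF.uniformOfFintype Player).map fun j => .turn ⟨j, 0, 0, 0⟩ (valid_zero j)
  | .final, _, _ => PMF.pure .final
  | .turn x hx, a, b =>
      if hj : x.j = .one then moveLaw x hx a.1 (legal_of_allowed hj a.2)
      else moveLaw x hx b.1 (legal_of_allowed (eq_two_of_ne_one hj) b.2)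

/-- The amount that player two pays to player one in a state. -/
def payoff : DiceState v → ℝ
  | .start => 0
  | .final => 0
  | .turn ⟨.one, α, β, τ⟩ _ =>
      if 200 ≤ α + τ then (if v = .difference then 200 - (β : ℝ) else 1) else 0
  | .turn ⟨.two, α, β, τ⟩ _ =>
      if 200 ≤ β + τ then (if v = .difference then (α : ℝ) - 200 else 0) else 0

end DiceState

/-- The dice game in the version `v`, as a stochastic game. -/
noncomputable def diceGame (v : DiceVariant) : StochasticGame where
  S := DiceState v
  A := DiceState.Action .one
  B := DiceState.Action .two
  r := fun s _ _ => s.payoff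
  P := DiceState.transition

/-! The argument combines a verification theorem for perfect-information games with a potential that
forces the game to end.

Only the player with the die has a choice, so every matrix `M_x^s` has a single row or a single
column and hence a saddle point in pure actions (`exists_isSaddle`). This yields monotonicity of
`U`, and pure stationary strategies from any fixed point of `U`.

A potential `w ≥ 0` drops by at least one in expectation in each step from a state with `w ≠ 0`.
Telescoping bounds the expected number of visits to such states by `w s`; since no payments occur
where `w = 0`, the series for `V` converges absolutely. If `x` vanishes where `w` does, then `E
x(S_n) → 0`. A player who plays optimally in the matrices `M_x^s` of a fixed point `x` makes the
payments so far plus `x(S_n)` a sub- or supermartingale, so guarantees `x` (`le_V`, `V_le`). Thus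
such a fixed point is the value, which also gives uniqueness (`value_eq`). Existence is
Knaster–Tarski: with `C` bounding the payments, `U` maps the order interval from `-C w` to `C w`
into itself.

The potential comes from a rank. Whatever the players decide, the game is driven to its end if
player one always rolls a suitable number (usually a six) and player two always rolls an ace. A
missing distance of `d` points costs `⌈d/6⌉ = (205 - score) / 6` favourable numbers, each with at
most three steps (roll, stop, opponent's ace) and two prescribed rolls. The target is reached within
103 steps with probability at least `6⁻¹ ^ 68`, which gives the geometric bound and, through an
exponential function of the rank, the potential (`IsRank.exists_isPotential`).

When exactly 200 points are needed, a player with 199 banked points would need a one, which is an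
ace. Forbidding this bank restores the argument. If it is allowed, the states in which player one is
stuck at 199 form, with the final state, an absorbing set without payments (`decided`), and the
potential vanishes there. -/

/-! ### Expectations with respect to a probability mass function -/

namespace PMF

variable {α β : Type*}

/-- The expectation of a (bounded) real function. -/
noncomputable def expect (p : PMF α) (f : α → ℝ) : ℝ := ∑' a, (p a).toReal * f a

theorem hasSum_toReal (p : PMF α) : HasSum (fun a => (p a).toReal) 1 := by
  have h := ENNReal.hasSum_toReal p.tsum_coe_ne_top
  rwa [← ENNReal.tsum_toReal_eq p.apply_ne_top, p.tsum_coe, ENNReal.toReal_one] at h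

theorem summable_expect (p : PMF α) {f : α → ℝ} {C : ℝ} (hf : ∀ a, |f a| ≤ C) :
    Summable fun a => (p a).toReal * f a := by
  refine Summable.of_norm_bounded (p.hasSum_toReal.summable.mul_right C) fun a => ?_
  rw [Real.norm_eq_abs, abs_mul, abs_of_nonneg ENNReal.toReal_nonneg]
  exact mul_le_mul_of_nonneg_left (hf a) ENNReal.toReal_nonneg

theorem expect_fintype [Fintype α] (p : PMF α) (f : α → ℝ) :
    p.expect f = ∑ a, (p a).toReal * f a := tsum_fintype _

@[simp]
theorem expect_pure (a : α) (f : α → ℝ) : (PMF.pure a).expect f = f a := by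
  classical
  rw [expect, tsum_eq_single a]
  · simp
  · intro b hb
    simp [hb]

@[simp]
theorem expect_const (p : PMF α) (c : ℝ) : (p.expect fun _ => c) = c := by
  rw [expect, tsum_mul_right, p.hasSum_toReal.tsum_eq, one_mul]

theorem expect_mono (p : PMF α) {f g : α → ℝ} {C D : ℝ} (hf : ∀ a, |f a| ≤ C)
    (hg : ∀ a, |g a| ≤ D) (h : ∀ a, f a ≤ g a) : p.expect f ≤ p.expect g :=
  (p.summable_expect hf).tsum_le_tsum
    (fun a => mul_le_mul_of_nonneg_left (h a) ENNReal.toReal_nonneg) (p.summable_expect hg)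

theorem expect_add (p : PMF α) {f g : α → ℝ} {C D : ℝ} (hf : ∀ a, |f a| ≤ C)
    (hg : ∀ a, |g a| ≤ D) : (p.expect fun a => f a + g a) = p.expect f + p.expect g := by
  simp only [expect, mul_add]
  exact (p.summable_expect hf).tsum_add (p.summable_expect hg)

theorem expect_const_mul (p : PMF α) (c : ℝ) (f : α → ℝ) :
    (p.expect fun a => c * f a) = c * p.expect f := by
  simp only [expect, ← tsum_mul_left]
  exact tsum_congr fun a => by ring

theorem expect_nonneg (p : PMF α) {f : α → ℝ} (h : ∀ a, 0 ≤ f a) : 0 ≤ p.expect f :=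
  tsum_nonneg fun a => mul_nonneg ENNReal.toReal_nonneg (h a)

theorem abs_expect_le (p : PMF α) {f g : α → ℝ} {C : ℝ} (hg : ∀ a, |g a| ≤ C)
    (h : ∀ a, |f a| ≤ g a) : |p.expect f| ≤ p.expect g := by
  have hf : ∀ a, |f a| ≤ C := fun a => (h a).trans ((le_abs_self _).trans (hg a))
  rw [abs_le]
  constructor
  · have := p.expect_mono (f := fun a => -1 * g a) (g := f) (C := C)
      (fun a => by simpa using hg a) hf (fun a => by linarith [neg_abs_le (f a), h a])
    rw [expect_const_mul] at this
    linarith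
  · exact p.expect_mono hf hg fun a => (le_abs_self _).trans (h a)

theorem abs_expect_le_const (p : PMF α) {f : α → ℝ} {C : ℝ} (h : ∀ a, |f a| ≤ C) :
    |p.expect f| ≤ C := by
  have := p.abs_expect_le (g := fun _ => C) (C := |C|) (fun _ => le_rfl) h
  simpa using this

/-- Fubini: the products `p a * q a b` form a probability on pairs and `f` is bounded, so the double
series converges absolutely. Bounds are needed because histories form an infinite type and a
non-summable `tsum` is zero by convention. -/
theorem expect_bind (p : PMF α) (q : α → PMF β) {f : β → ℝ} {C : ℝ} (hf : ∀ b, |f b| ≤ C) :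
    (p.bind q).expect f = p.expect fun a => (q a).expect f := by
  have hq : ∀ b, (p.bind q b).toReal = ∑' a, (p a).toReal * (q a b).toReal := by
    intro b
    rw [PMF.bind_apply, ENNReal.tsum_toReal_eq]
    · simp only [ENNReal.toReal_mul]
    · exact fun a => ENNReal.mul_ne_top (p.apply_ne_top a) ((q a).apply_ne_top b)
  have hs : Summable fun x : α × β => (p x.1).toReal * (q x.1 x.2).toReal := by
    have h2 : ∀ a, Summable fun b => (p a).toReal * (q a b).toReal :=
      fun a => Summable.mul_left (p a).toReal (q a).hasSum_toReal.summable
    have h0 : 0 ≤ fun x : α × β => (p x.1).toReal * (q x.1 x.2).toReal :=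
      fun x => mul_nonneg ENNReal.toReal_nonneg ENNReal.toReal_nonneg
    rw [summable_prod_of_nonneg h0]
    constructor
    · exact h2
    · have h1 : ∀ a, ∑' b, (p a).toReal * (q a b).toReal = (p a).toReal := fun a => by
        rw [tsum_mul_left, (q a).hasSum_toReal.tsum_eq, mul_one]
      simp only [h1]
      exact p.hasSum_toReal.summable
  have hsf : Summable fun x : α × β => (p x.1).toReal * (q x.1 x.2).toReal * f x.2 := by
    refine Summable.of_norm_bounded (hs.mul_right C) fun x => ?_
    rw [Real.norm_eq_abs, abs_mul, abs_of_nonneg (by positivity)]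
    exact mul_le_mul_of_nonneg_left (hf _) (by positivity)
  simp only [expect, hq, ← tsum_mul_left, ← tsum_mul_right, ← mul_assoc]
  exact (Summable.tsum_comm (f := fun a b => (p a).toReal * (q a b).toReal * f b) hsf)

theorem expect_map (p : PMF α) (g : α → β) {f : β → ℝ} {C : ℝ} (hf : ∀ b, |f b| ≤ C) :
    (p.map g).expect f = p.expect fun a => f (g a) := by
  rw [← PMF.bind_pure_comp, expect_bind p _ hf]
  simp

/-! ### Expectations in `[0, ∞]`, free of summability conditions -/

/-- The expectation of a function with values in `[0, ∞]`. -/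
noncomputable def lexpect (p : PMF α) (f : α → ℝ≥0∞) : ℝ≥0∞ := ∑' a, p a * f a

theorem lexpect_mono (p : PMF α) {f g : α → ℝ≥0∞} (h : ∀ a, f a ≤ g a) :
    p.lexpect f ≤ p.lexpect g :=
  ENNReal.tsum_le_tsum fun a => mul_le_mul_right (h a) _

theorem lexpect_bind (p : PMF α) (q : α → PMF β) (f : β → ℝ≥0∞) :
    (p.bind q).lexpect f = p.lexpect fun a => (q a).lexpect f := by
  simp only [lexpect, PMF.bind_apply, ← ENNReal.tsum_mul_left, ← ENNReal.tsum_mul_right, mul_assoc]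
  exact ENNReal.tsum_comm

@[simp]
theorem lexpect_pure (a : α) (f : α → ℝ≥0∞) : (PMF.pure a).lexpect f = f a := by
  classical
  rw [lexpect, tsum_eq_single a]
  · simp
  · intro b hb
    simp [hb]

theorem lexpect_map (p : PMF α) (g : α → β) (f : β → ℝ≥0∞) :
    (p.map g).lexpect f = p.lexpect fun a => f (g a) := by
  rw [← PMF.bind_pure_comp, lexpect_bind]
  simp

theorem lexpect_const_mul (p : PMF α) (c : ℝ≥0∞) (f : α → ℝ≥0∞) :
    (p.lexpect fun a => c * f a) = c * p.lexpect f := by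
  simp only [lexpect, ← ENNReal.tsum_mul_left]
  exact tsum_congr fun a => by ring

@[simp]
theorem lexpect_const (p : PMF α) (c : ℝ≥0∞) : (p.lexpect fun _ => c) = c := by
  rw [lexpect, ENNReal.tsum_mul_right, p.tsum_coe, one_mul]

theorem lexpect_add (p : PMF α) (f g : α → ℝ≥0∞) :
    (p.lexpect fun a => f a + g a) = p.lexpect f + p.lexpect g := by
  simp only [lexpect, mul_add]
  exact ENNReal.tsum_add

theorem mul_le_lexpect (p : PMF α) (f : α → ℝ≥0∞) (a : α) : p a * f a ≤ p.lexpect f :=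
  ENNReal.le_tsum a

theorem lexpect_indicator (p : PMF α) (s : Set α) :
    p.lexpect (s.indicator 1) = p.toOuterMeasure s := by
  rw [PMF.toOuterMeasure_apply, lexpect]
  refine tsum_congr fun a => ?_
  by_cases h : a ∈ s <;> simp [h]

theorem toReal_lexpect_ofReal (p : PMF α) {f : α → ℝ} (hf : ∀ a, 0 ≤ f a) :
    (p.lexpect fun a => ENNReal.ofReal (f a)).toReal = p.expect f := by
  rw [lexpect, ENNReal.tsum_toReal_eq]
  · simp only [ENNReal.toReal_mul, ENNReal.toReal_ofReal (hf _)]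
    rfl
  · exact fun a => ENNReal.mul_ne_top (p.apply_ne_top a) ENNReal.ofReal_ne_top

end PMF

theorem exists_abs_le {α : Type*} [Finite α] (f : α → ℝ) : ∃ C, 0 ≤ C ∧ ∀ a, |f a| ≤ C := by
  obtain ⟨C, hC⟩ := (Set.finite_range fun a => |f a|).bddAbove
  exact ⟨max C 0, le_max_right _ _, fun a => (hC ⟨a, rfl⟩).trans (le_max_left _ _)⟩

/-! ### Matrix games in which one of the players has a single action -/

section MatrixGame

variable {X Y : Type} [Fintype X] [Fintype Y]

theorem matrixPay_eq_expect (M : X → Y → ℝ) (p : PMF X) (q : PMF Y) :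
    matrixPay M p q = p.expect fun a => q.expect fun b => M a b := by
  simp only [matrixPay, PMF.expect_fintype, Finset.mul_sum]
  exact Finset.sum_congr rfl fun a _ => Finset.sum_congr rfl fun b _ => by ring

theorem matrixPay_mono {M N : X → Y → ℝ} (h : ∀ a b, M a b ≤ N a b) (p : PMF X) (q : PMF Y) :
    matrixPay M p q ≤ matrixPay N p q :=
  Finset.sum_le_sum fun a _ => Finset.sum_le_sum fun b _ =>
    mul_le_mul_of_nonneg_left (h a b) (by positivity)

theorem matrixPay_add (M N : X → Y → ℝ) (p : PMF X) (q : PMF Y) :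
    matrixPay (fun a b => M a b + N a b) p q = matrixPay M p q + matrixPay N p q := by
  simp only [matrixPay, mul_add, Finset.sum_add_distrib]

@[simp]
theorem matrixPay_const (c : ℝ) (p : PMF X) (q : PMF Y) : matrixPay (fun _ _ => c) p q = c := by
  simp [matrixPay_eq_expect]

theorem abs_matrixPay_le {M : X → Y → ℝ} {C : ℝ} (h : ∀ a b, |M a b| ≤ C) (p : PMF X)
    (q : PMF Y) : |matrixPay M p q| ≤ C := by
  rw [matrixPay_eq_expect]
  exact p.abs_expect_le_const fun a => q.abs_expect_le_const fun b => h a b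

/-- The entry at `(a, b)` is a saddle point, also with respect to mixed actions. -/
def IsSaddle (M : X → Y → ℝ) (a : X) (b : Y) : Prop :=
  (∀ q, M a b ≤ matrixPay M (PMF.pure a) q) ∧ ∀ p, matrixPay M p (PMF.pure b) ≤ M a b

/-- With a single row the smallest entry is a saddle point, with a single column the largest. -/
theorem exists_isSaddle [Nonempty X] [Nonempty Y] (h : Subsingleton X ∨ Subsingleton Y)
    (M : X → Y → ℝ) : ∃ a b, IsSaddle M a b := by
  rcases h with h | h
  · obtain ⟨a⟩ := ‹Nonempty X›
    obtain ⟨b, hb⟩ := Finite.exists_min fun b => M a b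
    refine ⟨a, b, fun q => ?_, fun p => ?_⟩
    · calc M a b = matrixPay (fun _ _ => M a b) (PMF.pure a) q := (matrixPay_const _ _ _).symm
        _ ≤ _ := matrixPay_mono (fun a' b' => by rw [Subsingleton.elim a' a]; exact hb b') _ _
    · simp only [matrixPay_eq_expect, PMF.expect_pure]
      have : ∀ a', M a' b = M a b := fun a' => by rw [Subsingleton.elim a' a]
      simp [this]
  · obtain ⟨b⟩ := ‹Nonempty Y›
    obtain ⟨a, ha⟩ := Finite.exists_max fun a => M a b
    refine ⟨a, b, fun q => ?_, fun p => ?_⟩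
    · simp only [matrixPay_eq_expect, PMF.expect_pure]
      have : ∀ b', M a b' = M a b := fun b' => by rw [Subsingleton.elim b' b]
      simp [this]
    · calc matrixPay M p (PMF.pure b) ≤ matrixPay (fun _ _ => M a b) p (PMF.pure b) :=
            matrixPay_mono (fun a' b' => by rw [Subsingleton.elim b' b]; exact ha a') _ _
        _ = M a b := matrixPay_const _ _ _

theorem IsSaddle.matrixValue_eq [Nonempty Y] {M : X → Y → ℝ} {a : X} {b : Y}
    (h : IsSaddle M a b) : matrixValue M = M a b := by
  obtain ⟨C, -, hC⟩ := exists_abs_le fun x : X × Y => M x.1 x.2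
  -- Real suprema and infima have default values on unbounded sets, so boundedness must be supplied.
  have hbd : ∀ p, BddBelow (Set.range fun q => matrixPay M p q) := fun p =>
    ⟨-C, by rintro _ ⟨q, rfl⟩; exact (abs_le.1 (abs_matrixPay_le (fun a b => hC (a, b)) p q)).1⟩
  have hle : ∀ p, ⨅ q, matrixPay M p q ≤ M a b := fun p => (ciInf_le (hbd p) _).trans (h.2 p)
  have : Nonempty (PMF X) := ⟨PMF.pure a⟩
  have : Nonempty (PMF Y) := ⟨PMF.pure b⟩
  refine le_antisymm (ciSup_le hle) ?_
  exact (le_ciInf h.1).trans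
    (le_ciSup (f := fun p => ⨅ q, matrixPay M p q) ⟨M a b, by rintro _ ⟨p, rfl⟩; exact hle p⟩ _)

theorem matrixValue_mono [Nonempty X] [Nonempty Y] (h : Subsingleton X ∨ Subsingleton Y)
    {M N : X → Y → ℝ} (hMN : ∀ a b, M a b ≤ N a b) : matrixValue M ≤ matrixValue N := by
  obtain ⟨a, b, hM⟩ := exists_isSaddle h M
  obtain ⟨a', b', hN⟩ := exists_isSaddle h N
  rw [hM.matrixValue_eq, hN.matrixValue_eq]
  exact (hM.1 _).trans ((matrixPay_mono hMN _ (PMF.pure b')).trans (hN.2 _))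

end MatrixGame

namespace StochasticGame

variable {G : StochasticGame}

/-! ### Laws of histories -/

/-- Chapman–Kolmogorov. The definition appends steps at the end; this identity also allows
conditioning on the first step or on a block of steps. -/
theorem historyLawFrom_add (π : G.Strategy₁) (φ : G.Strategy₂) (h : G.History) (m n : ℕ) :
    historyLawFrom π φ h (m + n) =
      (historyLawFrom π φ h m).bind fun h' => historyLawFrom π φ h' n := by
  induction n with
  | zero => simp [historyLawFrom]
  | succ n ih => rw [← Nat.add_assoc, historyLawFrom, ih, PMF.bind_bind]; rfl

/-- The expectation of `x(S')`, where `S'` is the state reached from `s` with the actions `a`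
and `b`. -/
noncomputable def nextMatrix (G : StochasticGame) (x : G.S → ℝ) (s : G.S) (a : G.A s)
    (b : G.B s) : ℝ :=
  (G.P s a b).expect x

theorem auxMatrix_eq (x : G.S → ℝ) (s : G.S) (a : G.A s) (b : G.B s) :
    G.auxMatrix x s a b = G.r s a b + G.nextMatrix x s a b := by
  rw [nextMatrix, PMF.expect_fintype, auxMatrix]

theorem expect_actionLaw (π : G.Strategy₁) (φ : G.Strategy₂) (h : G.History) (f : G.K → ℝ) :
    (actionLaw π φ h).expect f = matrixPay (fun a b => f ⟨h.2, a, b⟩) (π h) (φ h) := by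
  obtain ⟨C, -, hC⟩ := exists_abs_le f
  rw [actionLaw, PMF.expect_bind _ _ hC, matrixPay_eq_expect]
  simp only [PMF.expect_map _ _ hC]

theorem expect_stepLaw (π : G.Strategy₁) (φ : G.Strategy₂) (h : G.History) (x : G.S → ℝ) :
    (stepLaw π φ h).expect (fun h' => x h'.2) =
      matrixPay (G.nextMatrix x h.2) (π h) (φ h) := by
  obtain ⟨C, -, hC⟩ := exists_abs_le x
  have hC' : ∀ h' : G.History, |x h'.2| ≤ C := fun h' => hC _
  rw [stepLaw, PMF.expect_bind _ _ hC', expect_actionLaw]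
  simp only [PMF.expect_map _ _ hC']
  rfl

/-- The expectation of `x(S_t)` under `P_{s,π,φ}`. -/
noncomputable def expectedState (π : G.Strategy₁) (φ : G.Strategy₂) (s : G.S) (t : ℕ)
    (x : G.S → ℝ) : ℝ :=
  (historyLawFrom π φ ([], s) t).expect fun h => x h.2

theorem expectedPay_eq (π : G.Strategy₁) (φ : G.Strategy₂) (s : G.S) (t : ℕ) :
    expectedPay π φ s t =
      (historyLawFrom π φ ([], s) t).expect fun h => matrixPay (G.r h.2) (π h) (φ h) := by
  obtain ⟨C, -, hC⟩ := exists_abs_le fun k : G.K => G.r k.1 k.2.1 k.2.2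
  rw [expectedPay, ← PMF.expect_fintype _ (fun k : G.K => G.r k.1 k.2.1 k.2.2), tripleLaw,
    PMF.expect_bind _ _ hC]
  simp only [expect_actionLaw]

theorem expectedState_succ (π : G.Strategy₁) (φ : G.Strategy₂) (s : G.S) (t : ℕ)
    (x : G.S → ℝ) :
    expectedState π φ s (t + 1) x =
      (historyLawFrom π φ ([], s) t).expect
        fun h => matrixPay (G.nextMatrix x h.2) (π h) (φ h) := by
  obtain ⟨C, -, hC⟩ := exists_abs_le x
  rw [expectedState, historyLawFrom, PMF.expect_bind _ _ (fun h' : G.History => hC h'.2)]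
  simp only [expect_stepLaw]

theorem abs_nextMatrix_le {x : G.S → ℝ} {C : ℝ} (h : ∀ s, |x s| ≤ C) (s : G.S) (a : G.A s)
    (b : G.B s) : |G.nextMatrix x s a b| ≤ C :=
  PMF.abs_expect_le_const _ h

theorem exists_abs_r_le (G : StochasticGame) : ∃ C, 0 ≤ C ∧ ∀ s a b, |G.r s a b| ≤ C := by
  obtain ⟨C, h0, hC⟩ := exists_abs_le fun k : G.K => G.r k.1 k.2.1 k.2.2
  exact ⟨C, h0, fun s a b => hC ⟨s, a, b⟩⟩

theorem expect_matrixPay_auxMatrix (π : G.Strategy₁) (φ : G.Strategy₂) (s : G.S) (t : ℕ)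
    (x : G.S → ℝ) :
    ((historyLawFrom π φ ([], s) t).expect
        fun h => matrixPay (G.auxMatrix x h.2) (π h) (φ h)) =
      expectedPay π φ s t + expectedState π φ s (t + 1) x := by
  obtain ⟨C, -, hC⟩ := exists_abs_le x
  obtain ⟨D, -, hD⟩ := exists_abs_r_le G
  rw [expectedState_succ, expectedPay_eq, ← PMF.expect_add _
    (fun h => abs_matrixPay_le (hD h.2) (π h) (φ h))
    (fun h => abs_matrixPay_le (abs_nextMatrix_le hC h.2) (π h) (φ h))]
  simp only [← matrixPay_add, ← auxMatrix_eq]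

theorem abs_matrixPay_auxMatrix_le (x : G.S → ℝ) : ∃ C, ∀ s (p : PMF (G.A s)) (q : PMF (G.B s)),
    |matrixPay (G.auxMatrix x s) p q| ≤ C := by
  obtain ⟨C, -, hC⟩ := exists_abs_le fun k : G.K => G.auxMatrix x k.1 k.2.1 k.2.2
  exact ⟨C, fun s p q => abs_matrixPay_le (fun a b => hC ⟨s, a, b⟩) p q⟩

@[simp]
theorem expectedState_zero (π : G.Strategy₁) (φ : G.Strategy₂) (s : G.S) (x : G.S → ℝ) :
    expectedState π φ s 0 x = x s := by
  simp [expectedState, historyLawFrom]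

end StochasticGame

namespace StochasticGame

variable {G : StochasticGame}

/-! ### Games with a potential -/

/-- In every state one of the players has only one action. -/
def IsPerfectInformation (G : StochasticGame) : Prop :=
  ∀ s, Subsingleton (G.A s) ∨ Subsingleton (G.B s)

open Classical in
/-- A nonnegative function `w` whose expectation decreases by one in every step from a state
where `w` does not vanish, while no payments occur where it vanishes. -/
structure IsPotential (w : G.S → ℝ) : Prop where
  nonneg : ∀ s, 0 ≤ w s
  drift : ∀ s a b, (if w s = 0 then (0 : ℝ) else 1) + G.nextMatrix w s a b ≤ w s
  pay : ∀ s a b, w s = 0 → G.r s a b = 0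

namespace IsPotential

variable {w : G.S → ℝ}

open Classical in
/-- The indicator function of the states where the potential does not vanish. -/
noncomputable def active (w : G.S → ℝ) (s : G.S) : ℝ := if w s = 0 then 0 else 1

theorem active_nonneg (s : G.S) : 0 ≤ active w s := by
  unfold active; split_ifs <;> norm_num

theorem abs_active_le (s : G.S) : |active w s| ≤ 1 := by
  unfold active; split_ifs <;> norm_num

theorem expectedState_active_nonneg (π : G.Strategy₁) (φ : G.Strategy₂) (s : G.S) (t : ℕ) :
    0 ≤ expectedState π φ s t (active w) :=
  PMF.expect_nonneg _ fun _ => active_nonneg _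

theorem expectedState_drift (hw : IsPotential w) (π : G.Strategy₁) (φ : G.Strategy₂) (s : G.S)
    (t : ℕ) : expectedState π φ s t (active w) + expectedState π φ s (t + 1) w ≤
      expectedState π φ s t w := by
  obtain ⟨C, -, hC⟩ := exists_abs_le w
  rw [expectedState_succ, expectedState, expectedState, ← PMF.expect_add _
    (fun h => abs_active_le h.2)
    (fun h => abs_matrixPay_le (abs_nextMatrix_le hC h.2) (π h) (φ h))]
  refine PMF.expect_mono _ (C := 1 + C) (fun h => (abs_add_le _ _).trans (add_le_add
    (abs_active_le h.2) (abs_matrixPay_le (abs_nextMatrix_le hC h.2) (π h) (φ h))))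
    (fun h => hC h.2) fun h => ?_
  rw [← matrixPay_const (active w h.2) (π h) (φ h), ← matrixPay_add,
    ← matrixPay_const (w h.2) (π h) (φ h)]
  exact matrixPay_mono (fun a b => hw.drift h.2 a b) _ _

/-- The drift inequality telescopes, and the remaining term `E w(S_n)` is nonnegative. -/
theorem sum_expectedState_active_le (hw : IsPotential w) (π : G.Strategy₁) (φ : G.Strategy₂)
    (s : G.S) (n : ℕ) : ∑ t ∈ Finset.range n, expectedState π φ s t (active w) ≤ w s := by
  have key : ∑ t ∈ Finset.range n, expectedState π φ s t (active w) +
      expectedState π φ s n w ≤ w s := by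
    induction n with
    | zero => simp
    | succ n ih =>
      rw [Finset.sum_range_succ]
      linarith [hw.expectedState_drift π φ s n]
  have : 0 ≤ expectedState π φ s n w := PMF.expect_nonneg _ fun h => hw.nonneg _
  linarith

theorem summable_expectedState_active (hw : IsPotential w) (π : G.Strategy₁) (φ : G.Strategy₂)
    (s : G.S) : Summable fun t => expectedState π φ s t (active w) :=
  summable_of_sum_range_le (fun t => expectedState_active_nonneg π φ s t)
    (hw.sum_expectedState_active_le π φ s)

theorem abs_expectedState_le {x : G.S → ℝ} {C : ℝ} (hx : ∀ s, w s = 0 → x s = 0)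
    (hC : ∀ s, |x s| ≤ C) (π : G.Strategy₁) (φ : G.Strategy₂) (s : G.S) (t : ℕ) :
    |expectedState π φ s t x| ≤ C * expectedState π φ s t (active w) := by
  rw [expectedState, expectedState, ← PMF.expect_const_mul]
  refine PMF.abs_expect_le _ (C := |C|) (fun h => ?_) fun h => ?_
  · rw [abs_mul]
    exact mul_le_of_le_one_right (abs_nonneg _) (abs_active_le _)
  · by_cases h0 : w h.2 = 0
    · simp [active, h0, hx]
    · simpa [active, h0] using hC h.2

theorem abs_expectedPay_le (hw : IsPotential w) {C : ℝ} (hC : ∀ s a b, |G.r s a b| ≤ C)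
    (π : G.Strategy₁) (φ : G.Strategy₂) (s : G.S) (t : ℕ) :
    |expectedPay π φ s t| ≤ C * expectedState π φ s t (active w) := by
  rw [expectedPay_eq, expectedState, ← PMF.expect_const_mul]
  refine PMF.abs_expect_le _ (C := |C|) (fun h => ?_) fun h => ?_
  · rw [abs_mul]
    exact mul_le_of_le_one_right (abs_nonneg _) (abs_active_le _)
  · refine abs_matrixPay_le (fun a b => ?_) _ _
    by_cases h0 : w h.2 = 0
    · simp [active, h0, hw.pay _ a b h0]
    · simpa [active, h0] using hC h.2 a b

theorem summable_expectedPay (hw : IsPotential w) (π : G.Strategy₁) (φ : G.Strategy₂) (s : G.S) :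
    Summable fun t => expectedPay π φ s t := by
  obtain ⟨C, -, hC⟩ := exists_abs_r_le G
  exact Summable.of_norm_bounded ((hw.summable_expectedState_active π φ s).mul_left C)
    fun t => hw.abs_expectedPay_le hC π φ s t

theorem tendsto_expectedState (hw : IsPotential w) {x : G.S → ℝ} (hx : ∀ s, w s = 0 → x s = 0)
    (π : G.Strategy₁) (φ : G.Strategy₂) (s : G.S) :
    Filter.Tendsto (fun t => expectedState π φ s t x) Filter.atTop (nhds 0) := by
  obtain ⟨C, -, hC⟩ := exists_abs_le x
  refine squeeze_zero_norm (fun t => abs_expectedState_le hx hC π φ s t) ?_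
  simpa using (hw.summable_expectedState_active π φ s).tendsto_atTop_zero.const_mul C

theorem tendsto_partial_sums (hw : IsPotential w) {x : G.S → ℝ}
    (hx : ∀ s, w s = 0 → x s = 0) (π : G.Strategy₁) (φ : G.Strategy₂) (s : G.S) :
    Filter.Tendsto (fun n => ∑ t ∈ Finset.range n, expectedPay π φ s t + expectedState π φ s n x)
      Filter.atTop (nhds (V π φ s)) := by
  simpa [V] using (hw.summable_expectedPay π φ s).hasSum.tendsto_sum_nat.add
    (hw.tendsto_expectedState hx π φ s)

/-- The payments before time `n` plus `x(S_n)` have an expectation that is nondecreasing in `n`,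
starts at `x s` and tends to `V π φ s`, since `E x(S_n)` tends to zero. -/
theorem le_V (hw : IsPotential w) {x : G.S → ℝ} (hx : ∀ s, w s = 0 → x s = 0)
    {π : G.Strategy₁} {φ : G.Strategy₂}
    (h : ∀ h : G.History, x h.2 ≤ matrixPay (G.auxMatrix x h.2) (π h) (φ h)) (s : G.S) :
    x s ≤ V π φ s := by
  obtain ⟨C, -, hC⟩ := exists_abs_le x
  obtain ⟨D, hD⟩ := abs_matrixPay_auxMatrix_le x
  refine ge_of_tendsto' (hw.tendsto_partial_sums hx π φ s) fun n => ?_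
  induction n with
  | zero => simp
  | succ n ih =>
    have := (historyLawFrom π φ ([], s) n).expect_mono (fun h => hC h.2)
      (fun h => hD h.2 (π h) (φ h)) h
    rw [expect_matrixPay_auxMatrix] at this
    rw [Finset.sum_range_succ]
    unfold expectedState at *
    linarith

theorem V_le (hw : IsPotential w) {x : G.S → ℝ} (hx : ∀ s, w s = 0 → x s = 0)
    {π : G.Strategy₁} {φ : G.Strategy₂}
    (h : ∀ h : G.History, matrixPay (G.auxMatrix x h.2) (π h) (φ h) ≤ x h.2) (s : G.S) :
    V π φ s ≤ x s := by
  obtain ⟨C, -, hC⟩ := exists_abs_le x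
  obtain ⟨D, hD⟩ := abs_matrixPay_auxMatrix_le x
  refine le_of_tendsto' (hw.tendsto_partial_sums hx π φ s) fun n => ?_
  induction n with
  | zero => simp
  | succ n ih =>
    have := (historyLawFrom π φ ([], s) n).expect_mono (fun h => hD h.2 (π h) (φ h))
      (fun h => hC h.2) h
    rw [expect_matrixPay_auxMatrix] at this
    rw [Finset.sum_range_succ]
    unfold expectedState at *
    linarith

end IsPotential

/-! ### The Shapley operator, the value and optimal strategies -/

theorem lowerValue_le_upperValue (s : G.S) : G.lowerValue s ≤ G.upperValue s :=
  iSup_iInf_le_iInf_iSup _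

theorem U_mono (hG : G.IsPerfectInformation) : Monotone G.U := by
  intro x y hxy s
  refine matrixValue_mono (hG s) fun a b => ?_
  simp only [auxMatrix]
  gcongr with s'
  exact hxy s'

/-- Pure stationary strategies that play a saddle point of each matrix `M_x^s`. -/
theorem exists_saddle_selection (hG : G.IsPerfectInformation) (x : G.S → ℝ) :
    ∃ (f : ∀ s, G.A s) (g : ∀ s, G.B s), ∀ s, IsSaddle (G.auxMatrix x s) (f s) (g s) := by
  choose f g h using fun s => exists_isSaddle (hG s) (G.auxMatrix x s)
  exact ⟨f, g, h⟩

theorem isPure₁_stationary₁_pure (f : ∀ s, G.A s) :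
    IsPure₁ (stationary₁ fun s => PMF.pure (f s)) :=
  fun h => ⟨f h.2, by simp [stationary₁]⟩

theorem isPure₂_stationary₂_pure (g : ∀ s, G.B s) :
    IsPure₂ (stationary₂ fun s => PMF.pure (g s)) :=
  fun h => ⟨g h.2, by simp [stationary₂]⟩

namespace IsPotential

variable {w : G.S → ℝ}

/-- Playing the row of a saddle point of each `M_x^s` secures at least `x` against every behaviour
strategy; playing the column concedes at most `x`. -/
theorem value_eq (hG : G.IsPerfectInformation) (hw : IsPotential w) {x : G.S → ℝ}
    (hx : ∀ s, w s = 0 → x s = 0) (hU : G.U x = x) (s : G.S) :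
    G.lowerValue s = x s ∧ G.upperValue s = x s := by
  obtain ⟨f, g, hfg⟩ := exists_saddle_selection hG x
  have hx' : ∀ s, G.auxMatrix x s (f s) (g s) = x s := fun s => by
    rw [← (hfg s).matrixValue_eq]
    exact congrFun hU s
  have h1 : (x s : EReal) ≤ G.lowerValue s :=
    le_iSup_of_le (stationary₁ fun s => PMF.pure (f s)) <| le_iInf fun φ =>
      EReal.coe_le_coe_iff.2 <| hw.le_V hx (fun h => (hx' h.2).ge.trans ((hfg h.2).1 (φ h))) s
  have h2 : G.upperValue s ≤ x s :=
    iInf_le_of_le (stationary₂ fun s => PMF.pure (g s)) <| iSup_le fun π =>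
      EReal.coe_le_coe_iff.2 <| hw.V_le hx (fun h => ((hfg h.2).2 (π h)).trans (hx' h.2).le) s
  have h3 := lowerValue_le_upperValue (G := G) s
  exact ⟨le_antisymm (h3.trans h2) h1, le_antisymm h2 (h1.trans h3)⟩

theorem isOptimal₁_stationary₁ (hG : G.IsPerfectInformation) (hw : IsPotential w) {x : G.S → ℝ}
    (hx : ∀ s, w s = 0 → x s = 0) (hU : G.U x = x) {σ : (s : G.S) → PMF (G.A s)}
    (hσ : ∀ s q, matrixValue (G.auxMatrix x s) ≤ matrixPay (G.auxMatrix x s) (σ s) q) :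
    IsOptimal₁ (stationary₁ σ) := by
  refine fun s => le_antisymm (le_iSup_of_le (stationary₁ σ) le_rfl) ?_
  rw [(hw.value_eq hG hx hU s).1]
  refine le_iInf fun φ => EReal.coe_le_coe_iff.2 <| hw.le_V hx (fun h => ?_) s
  exact (congrFun hU h.2).ge.trans (hσ h.2 (φ h))

theorem isOptimal₂_stationary₂ (hG : G.IsPerfectInformation) (hw : IsPotential w) {x : G.S → ℝ}
    (hx : ∀ s, w s = 0 → x s = 0) (hU : G.U x = x) {σ : (s : G.S) → PMF (G.B s)}
    (hσ : ∀ s p, matrixPay (G.auxMatrix x s) p (σ s) ≤ matrixValue (G.auxMatrix x s)) :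
    IsOptimal₂ (stationary₂ σ) := by
  refine fun s => le_antisymm ?_ (iInf_le_of_le (stationary₂ σ) le_rfl)
  rw [(hw.value_eq hG hx hU s).2]
  refine iSup_le fun π => EReal.coe_le_coe_iff.2 <| hw.V_le hx (fun h => ?_) s
  exact (hσ h.2 (π h)).trans (congrFun hU h.2).le

theorem exists_pure_stationary_optimal₁ (hG : G.IsPerfectInformation) (hw : IsPotential w)
    {x : G.S → ℝ} (hx : ∀ s, w s = 0 → x s = 0) (hU : G.U x = x) :
    ∃ π : G.Strategy₁, IsPure₁ π ∧ IsStationary₁ π ∧ IsOptimal₁ π := by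
  obtain ⟨f, g, hfg⟩ := exists_saddle_selection hG x
  refine ⟨_, isPure₁_stationary₁_pure f, ⟨_, rfl⟩, hw.isOptimal₁_stationary₁ hG hx hU ?_⟩
  exact fun s q => (hfg s).matrixValue_eq.le.trans ((hfg s).1 q)

theorem exists_pure_stationary_optimal₂ (hG : G.IsPerfectInformation) (hw : IsPotential w)
    {x : G.S → ℝ} (hx : ∀ s, w s = 0 → x s = 0) (hU : G.U x = x) :
    ∃ φ : G.Strategy₂, IsPure₂ φ ∧ IsStationary₂ φ ∧ IsOptimal₂ φ := by
  obtain ⟨f, g, hfg⟩ := exists_saddle_selection hG x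
  refine ⟨_, isPure₂_stationary₂_pure g, ⟨_, rfl⟩, hw.isOptimal₂_stationary₂ hG hx hU ?_⟩
  exact fun s p => ((hfg s).2 p).trans (hfg s).matrixValue_eq.ge

/-- Since payments are at most `C` in absolute value and vanish where `w` does, the drift of `w`
makes `C w` a supersolution and `-C w` a subsolution of `x = U x`. -/
theorem exists_fixed_point (hG : G.IsPerfectInformation) (hw : IsPotential w) :
    ∃ x : G.S → ℝ, (∀ s, w s = 0 → x s = 0) ∧ G.U x = x := by
  obtain ⟨C, hC0, hC⟩ := exists_abs_r_le G
  have hr : ∀ s a b, |G.r s a b| ≤ C * active w s := fun s a b => by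
    by_cases h0 : w s = 0
    · simp [active, h0, hw.pay _ a b h0]
    · simpa [active, h0] using hC s a b
  have hd : ∀ s a b, C * active w s + C * G.nextMatrix w s a b ≤ C * w s := fun s a b => by
    rw [← mul_add]
    exact mul_le_mul_of_nonneg_left (hw.drift s a b) hC0
  have hup : ∀ s, G.U (fun s => C * w s) s ≤ C * w s := fun s => by
    obtain ⟨a, b, hab⟩ := exists_isSaddle (hG s) (G.auxMatrix (fun s => C * w s) s)
    rw [U, hab.matrixValue_eq, auxMatrix_eq, nextMatrix, PMF.expect_const_mul]
    have := hd s a b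
    rw [nextMatrix] at this
    linarith [(abs_le.1 (hr s a b)).2]
  have hlo : ∀ s, -C * w s ≤ G.U (fun s => -C * w s) s := fun s => by
    obtain ⟨a, b, hab⟩ := exists_isSaddle (hG s) (G.auxMatrix (fun s => -C * w s) s)
    rw [U, hab.matrixValue_eq, auxMatrix_eq, nextMatrix, PMF.expect_const_mul]
    have := hd s a b
    rw [nextMatrix] at this
    linarith [(abs_le.1 (hr s a b)).1]
  have hle : (fun s => -C * w s) ≤ fun s => C * w s := fun s => by
    have := mul_nonneg hC0 (hw.nonneg s)
    change -C * w s ≤ C * w s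
    linarith
  -- With this fact the order interval is a complete lattice, on which the monotone map `U` has a
  -- least fixed point. Both ends of the interval vanish where `w` does.
  have hfact := Fact.mk hle
  let I := Set.Icc (fun s => -C * w s) (fun s => C * w s)
  let F : I →o I :=
    { toFun := fun x => ⟨G.U x.1, fun s => (hlo s).trans (U_mono hG x.2.1 s),
        fun s => (U_mono hG x.2.2 s).trans (hup s)⟩
      monotone' := fun x y hxy => U_mono hG hxy }
  refine ⟨F.lfp.1, fun s h0 => ?_, congrArg Subtype.val F.map_lfp⟩
  have h1 := F.lfp.2.1 s
  have h2 := F.lfp.2.2 s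
  simp only [h0, mul_zero] at h1 h2
  exact le_antisymm h2 h1

end IsPotential

end StochasticGame

namespace StochasticGame

variable {G : StochasticGame}

/-! ### Reaching a set of states with positive probability -/

theorem lexpect_stepLaw (π : G.Strategy₁) (φ : G.Strategy₂) (h : G.History) (g : G.S → ℝ≥0∞) :
    (stepLaw π φ h).lexpect (fun h' => g h'.2) =
      (π h).lexpect fun a => (φ h).lexpect fun b => (G.P h.2 a b).lexpect g := by
  simp only [stepLaw, actionLaw, PMF.lexpect_bind, PMF.lexpect_map]

theorem le_lexpect_stepLaw (π : G.Strategy₁) (φ : G.Strategy₂) {h : G.History}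
    {g : G.S → ℝ≥0∞} {c : ℝ≥0∞} (hc : ∀ a b, c ≤ (G.P h.2 a b).lexpect g) :
    c ≤ (stepLaw π φ h).lexpect fun h' => g h'.2 := by
  rw [lexpect_stepLaw]
  calc c = (π h).lexpect fun _ => (φ h).lexpect fun _ => c := by simp
    _ ≤ _ := PMF.lexpect_mono _ fun a => PMF.lexpect_mono _ fun b => hc a b

/-- The probability that the state `n` steps later belongs to `F`, given the history. -/
noncomputable def hitProb (π : G.Strategy₁) (φ : G.Strategy₂) (F : Set G.S) (h : G.History)
    (n : ℕ) : ℝ≥0∞ :=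
  (historyLawFrom π φ h n).lexpect fun h' => F.indicator 1 h'.2

theorem stateLawFrom_toOuterMeasure (π : G.Strategy₁) (φ : G.Strategy₂) (F : Set G.S)
    (h : G.History) (n : ℕ) : (stateLawFrom π φ h n).toOuterMeasure F = hitProb π φ F h n := by
  rw [← PMF.lexpect_indicator, stateLawFrom, PMF.lexpect_map, hitProb]

theorem hitProb_add_compl (π : G.Strategy₁) (φ : G.Strategy₂) (F : Set G.S)
    (h : G.History) (n : ℕ) : hitProb π φ F h n + hitProb π φ Fᶜ h n = 1 := by
  classical
  rw [hitProb, hitProb, ← PMF.lexpect_add, ← PMF.lexpect_const (historyLawFrom π φ h n) 1]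
  congr 1
  funext h'
  by_cases hh : h'.2 ∈ F <;> simp [hh]

theorem hitProb_add (π : G.Strategy₁) (φ : G.Strategy₂) (F : Set G.S) (h : G.History) (m n : ℕ) :
    hitProb π φ F h (m + n) =
      (historyLawFrom π φ h m).lexpect fun h' => hitProb π φ F h' n := by
  simp only [hitProb, historyLawFrom_add, PMF.lexpect_bind]

/-- The set `F` is absorbing, and `T` and `R` bound the number of steps and of rolls of a die
that must turn out favourably to reach `F`, whatever the players do. -/
structure IsRank (F : Set G.S) (T R : G.S → ℕ) : Prop where
  absorbing : ∀ s ∈ F, ∀ a b, 1 ≤ (G.P s a b).lexpect (F.indicator 1)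
  rolls_eq_zero : ∀ s ∈ F, R s = 0
  step : ∀ s ∉ F, ∀ a b, (6 : ℝ≥0∞)⁻¹ ^ R s ≤
    (G.P s a b).lexpect fun s' => if T s' < T s then (6 : ℝ≥0∞)⁻¹ ^ R s' else 0

namespace IsRank

variable {F : Set G.S} {T R : G.S → ℕ}

/-- Induction on `n`, conditioning on the first step: from outside `F` the rank `T` drops on the
event that carries the weight, and inside `F` the state stays there. Counting rolls separately from
steps keeps the exponent smaller than the number of steps. -/
theorem pow_le_hitProb (hF : IsRank F T R) (π : G.Strategy₁) (φ : G.Strategy₂) (n : ℕ) :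
    ∀ h : G.History, (h.2 ∈ F ∨ T h.2 ≤ n) → (6 : ℝ≥0∞)⁻¹ ^ R h.2 ≤ hitProb π φ F h n := by
  classical
  induction n with
  | zero =>
    intro h hh
    -- Rank zero is impossible outside `F`: no successor could have smaller rank, so a positive
    -- number would be at most zero.
    have hm : h.2 ∈ F := by
      by_contra hm
      obtain ⟨a⟩ := G.nonemptyA h.2
      obtain ⟨b⟩ := G.nonemptyB h.2
      have h0 : T h.2 = 0 := Nat.le_zero.1 (hh.resolve_left hm)
      have := hF.step h.2 hm a b
      simp [h0] at this
    simp [hitProb, historyLawFrom, hm, hF.rolls_eq_zero]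
  | succ n ih =>
    intro h hh
    rw [Nat.add_comm, hitProb_add]
    have e : historyLawFrom π φ h 1 = stepLaw π φ h := by simp [historyLawFrom]
    rw [e]
    by_cases hm : h.2 ∈ F
    · rw [hF.rolls_eq_zero _ hm, pow_zero]
      refine (le_lexpect_stepLaw π φ (hF.absorbing h.2 hm)).trans (PMF.lexpect_mono _ fun h' => ?_)
      by_cases hm' : h'.2 ∈ F
      · have := ih h' (Or.inl hm')
        rw [hF.rolls_eq_zero _ hm'] at this
        simpa [hm'] using this
      · simp [hm']
    · refine (le_lexpect_stepLaw π φ (hF.step h.2 hm)).trans (PMF.lexpect_mono _ fun h' => ?_)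
      have h1 := hh.resolve_left hm
      by_cases hT : T h'.2 < T h.2
      · rw [if_pos hT]
        exact ih h' (Or.inr (by omega))
      · simp [hT]

/-- Each block of `m` steps is survived with conditional probability at most `1 - 6⁻¹ ^ r`, and not
at all from `F`. The offset `n` absorbs the remainder of the division by `m`. -/
theorem hitProb_compl_le (hF : IsRank F T R) {m r : ℕ} (hT : ∀ s, T s ≤ m) (hR : ∀ s, R s ≤ r)
    (π : G.Strategy₁) (φ : G.Strategy₂) (h : G.History) (k n : ℕ) :
    hitProb π φ Fᶜ h (n + m * k) ≤ (1 - (6 : ℝ≥0∞)⁻¹ ^ r) ^ k := by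
  classical
  have one : ∀ h' : G.History,
      hitProb π φ Fᶜ h' m ≤ (1 - (6 : ℝ≥0∞)⁻¹ ^ r) * Fᶜ.indicator 1 h'.2 := by
    intro h'
    have h1 := hitProb_add_compl π φ F h' m
    have h2 := hF.pow_le_hitProb π φ m h' (Or.inr (hT _))
    have h3 : hitProb π φ F h' m ≠ ⊤ := ne_top_of_le_ne_top ENNReal.one_ne_top
      (h1 ▸ le_self_add)
    have h4 : hitProb π φ Fᶜ h' m = 1 - hitProb π φ F h' m :=
      ENNReal.eq_sub_of_add_eq h3 (by rw [add_comm, h1])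
    rw [h4]
    by_cases hm : h'.2 ∈ F
    · rw [hF.rolls_eq_zero _ hm, pow_zero] at h2
      rw [tsub_eq_zero_of_le h2]
      exact zero_le
    · simp only [Set.mem_compl_iff, hm, not_false_eq_true, Set.indicator_of_mem, Pi.one_apply,
        mul_one]
      refine tsub_le_tsub_left (le_trans ?_ h2) _
      exact pow_le_pow_of_le_one zero_le (by simp) (hR _)
  induction k with
  | zero =>
    rw [pow_zero, ← hitProb_add_compl π φ F h (n + m * 0)]
    exact le_add_self
  | succ k ih =>
    rw [Nat.mul_succ, ← Nat.add_assoc, hitProb_add]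
    refine (PMF.lexpect_mono _ one).trans ?_
    rw [PMF.lexpect_const_mul, pow_succ']
    exact mul_le_mul_right ih _

theorem pow_le_stateLawFrom {sf : G.S} (hF : IsRank {sf} T R) {m r : ℕ} (hT : ∀ s, T s ≤ m)
    (hR : ∀ s, R s ≤ r) (π : G.Strategy₁) (φ : G.Strategy₂) (h : G.History) :
    (6 : ℝ≥0∞)⁻¹ ^ r ≤ stateLawFrom π φ h m sf := by
  rw [← PMF.toOuterMeasure_apply_singleton, stateLawFrom_toOuterMeasure]
  exact (pow_le_pow_of_le_one zero_le (by simp) (hR h.2)).trans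
    (hF.pow_le_hitProb π φ m h (Or.inr (hT h.2)))

theorem probNe_le {sf : G.S} (hF : IsRank {sf} T R) {m r : ℕ} (hT : ∀ s, T s ≤ m)
    (hR : ∀ s, R s ≤ r) (π : G.Strategy₁) (φ : G.Strategy₂) (s : G.S) (t : ℕ) :
    probNe π φ s t sf ≤ (1 - (6 : ℝ≥0∞)⁻¹ ^ r) ^ (t / m) := by
  rw [probNe, stateLaw, stateLawFrom_toOuterMeasure]
  conv_lhs => rw [← Nat.mod_add_div t m]
  exact hF.hitProb_compl_le hT hR π φ _ _ _

/-- The rank may jump up when the dice are unfavourable, so it is rescaled to the concave, bounded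
`q ^ N - q ^ (N - T)`. A decrease of `T`, of probability at least `p`, then outweighs any increase.
-/
theorem exists_isPotential (hF : IsRank F T R) (hr : ∀ s ∈ F, ∀ a b, G.r s a b = 0) :
    ∃ w : G.S → ℝ, IsPotential w ∧ ∀ s, w s = 0 ↔ s ∈ F := by
  classical
  obtain ⟨N, hN⟩ := (Set.finite_range T).bddAbove
  obtain ⟨r, hr'⟩ := (Set.finite_range R).bddAbove
  have hN : ∀ s, T s ≤ N := fun s => hN ⟨s, rfl⟩
  have hR : ∀ s, R s ≤ r := fun s => hr' ⟨s, rfl⟩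
  let T' : G.S → ℕ := fun s => if s ∈ F then 0 else T s
  have hT'T : ∀ s, T' s ≤ T s := fun s => by simp only [T']; split_ifs <;> omega
  set p : ℝ := (6⁻¹ : ℝ) ^ r with hp
  have hp0 : 0 < p := by positivity
  have hp1 : p ≤ 1 := pow_le_one₀ (by norm_num) (by norm_num)
  -- With `p * q = 2`, the expected gain `p * q ^ (N - T + 1)` is twice `q ^ (N - T)`, which leaves
  -- a drift of `q ^ (N - T) ≥ 1`.
  set q : ℝ := 2 / p with hq
  have hq2 : 2 ≤ q := by rw [hq, le_div_iff₀ hp0]; linarith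
  have hpq : p * q = 2 := by rw [hq]; field_simp
  have hq1 : 1 ≤ q := by linarith
  let w : G.S → ℝ := fun s => q ^ N - q ^ (N - T' s)
  have hpos : ∀ s ∉ F, 0 < T s := by
    intro s hs
    obtain ⟨a⟩ := G.nonemptyA s
    obtain ⟨b⟩ := G.nonemptyB s
    by_contra h0
    have := hF.step s hs a b
    simp [Nat.eq_zero_of_not_pos h0] at this
  have hw0 : ∀ s, 0 ≤ w s := fun s => sub_nonneg.2 (pow_le_pow_right₀ hq1 (Nat.sub_le _ _))
  have hwF : ∀ s, w s = 0 ↔ s ∈ F := by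
    intro s
    constructor
    · intro h
      by_contra hs
      have h1 : q ^ (N - T' s) < q ^ N := by
        apply pow_lt_pow_right₀ (by linarith)
        have := hpos s hs
        have := hN s
        simp only [T', hs, if_false]
        omega
      simp only [w] at h
      linarith
    · intro hs
      simp [w, T', hs]
  refine ⟨w, ⟨hw0, fun s a b => ?_, fun s a b h => hr s ((hwF s).1 h) a b⟩, hwF⟩
  by_cases hs : s ∈ F
  · have h1 := hF.absorbing s hs a b
    have hz : ∀ s', (G.P s a b s').toReal * w s' = 0 := by
      intro s'
      by_cases hs' : s' ∈ F
      · rw [(hwF s').2 hs', mul_zero]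
      · rw [PMF.lexpect_indicator] at h1
        -- The mass of `F` is at most that of the support, hence equal to one, so the support lies
        -- in `F`.
        have h2 := (PMF.toOuterMeasure_apply_eq_one_iff _ _).1
          (le_antisymm ((PMF.toOuterMeasure_mono _ (Set.inter_subset_right (s := F) (t := _))).trans
            (le_of_eq (PMF.toOuterMeasure_apply_eq_one_iff _ _ |>.2 subset_rfl))) h1)
        have h3 : G.P s a b s' = 0 := by
          by_contra h3
          exact hs' (h2 ((PMF.mem_support_iff _ _).2 h3))
        simp [h3]
    rw [nextMatrix, PMF.expect_fintype, Finset.sum_eq_zero fun s' _ => hz s', (hwF s).2 hs]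
    simp
  · have hws : w s = q ^ N - q ^ (N - T s) := by simp [w, T', hs]
    rw [if_neg fun h => hs ((hwF s).1 h), hws]
    let g : G.S → ℝ := fun s' => if T s' < T s then 1 else 0
    have hg0 : ∀ s', 0 ≤ g s' := fun s' => by simp only [g]; split_ifs <;> norm_num
    have hpg : p ≤ (G.P s a b).expect g := by
      rw [← PMF.toReal_lexpect_ofReal _ hg0]
      have h1 : (6 : ℝ≥0∞)⁻¹ ^ r ≤ (G.P s a b).lexpect fun s' => ENNReal.ofReal (g s') := by
        refine le_trans (pow_le_pow_of_le_one zero_le (by simp) (hR s)) ?_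
        refine (hF.step s hs a b).trans (PMF.lexpect_mono _ fun s' => ?_)
        by_cases hT : T s' < T s
        · simpa [g, hT] using pow_le_one₀ zero_le (by simp)
        · simp [hT]
      have h2 : ((G.P s a b).lexpect fun s' => ENNReal.ofReal (g s')) ≠ ⊤ := by
        refine ne_top_of_le_ne_top ENNReal.one_ne_top ?_
        rw [← PMF.lexpect_const (G.P s a b) 1]
        refine PMF.lexpect_mono _ fun s' => ?_
        simp only [g]; split_ifs <;> simp
      have h3 := ENNReal.toReal_mono h2 h1
      rwa [ENNReal.toReal_pow, ENNReal.toReal_inv, ENNReal.toReal_ofNat] at h3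
    have hle : ∀ s', w s' ≤ q ^ N + -q ^ (N - T s + 1) * g s' := by
      intro s'
      by_cases hT : T s' < T s
      · have h1 : q ^ (N - T s + 1) ≤ q ^ (N - T' s') := by
          refine pow_le_pow_right₀ hq1 ?_
          have := hT'T s'
          have := hN s
          omega
        simp only [w, g, hT, if_true]
        linarith
      · simp only [w, g, hT, if_false]
        have : 0 ≤ q ^ (N - T' s') := by positivity
        linarith
    have hsum : (G.P s a b).expect w ≤ q ^ N + -q ^ (N - T s + 1) * (G.P s a b).expect g := by
      obtain ⟨C, -, hC⟩ := exists_abs_le w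
      obtain ⟨D, -, hD⟩ := exists_abs_le fun s' => -q ^ (N - T s + 1) * g s'
      have h1 := PMF.expect_add (G.P s a b) (f := fun _ => q ^ N) (fun _ => le_rfl) hD
      rw [PMF.expect_const, PMF.expect_const_mul] at h1
      rw [← h1]
      exact PMF.expect_mono _ hC (fun s' => (abs_add_le _ _).trans
        (add_le_add le_rfl (hD s'))) hle
    have h1 : q ^ (N - T s + 1) * p ≤ q ^ (N - T s + 1) * (G.P s a b).expect g :=
      mul_le_mul_of_nonneg_left hpg (by positivity)
    have h2 : q ^ (N - T s + 1) * p = 2 * q ^ (N - T s) := by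
      rw [pow_succ, mul_assoc, mul_comm q p, hpq]; ring
    have h3 : 1 ≤ q ^ (N - T s) := one_le_pow₀ hq1
    rw [nextMatrix]
    linarith

end IsRank

/-- If `w` vanishes only at `sf`, then the probability of not being in `sf` is the expectation of
`active w`, which is summable in `t`. -/
theorem IsPotential.tsum_probNe_lt_top {w : G.S → ℝ} (hw : IsPotential w) {sf : G.S}
    (hsf : ∀ s, w s = 0 ↔ s = sf) (π : G.Strategy₁) (φ : G.Strategy₂) (s : G.S) :
    ∑' t, probNe π φ s t sf < ⊤ := by
  classical
  have h : ∀ t, probNe π φ s t sf = ENNReal.ofReal (expectedState π φ s t (active w)) := by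
    intro t
    rw [expectedState, ← PMF.toReal_lexpect_ofReal _
        (f := fun h : G.History => active w h.2) (fun h => active_nonneg h.2),
      probNe, stateLaw, stateLawFrom_toOuterMeasure, hitProb]
    have e : (fun h : G.History => ({sf}ᶜ : Set G.S).indicator (1 : G.S → ℝ≥0∞) h.2) =
        fun h => ENNReal.ofReal (active w h.2) := by
      funext h
      by_cases hh : h.2 = sf
      · simp [active, (hsf sf).2 rfl, hh]
      · simp [active, mt (hsf h.2).1 hh, hh]
    rw [e, ENNReal.ofReal_toReal]
    refine ne_top_of_le_ne_top ENNReal.one_ne_top ?_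
    rw [← PMF.lexpect_const (historyLawFrom π φ ([], s) t) 1]
    refine PMF.lexpect_mono _ fun h' => ?_
    rw [← ENNReal.ofReal_one]
    exact ENNReal.ofReal_le_ofReal ((le_abs_self _).trans (abs_active_le _))
  simp only [h]
  rw [← ENNReal.ofReal_tsum_of_nonneg (expectedState_active_nonneg π φ s)
    (hw.summable_expectedState_active π φ s)]
  exact ENNReal.ofReal_lt_top

end StochasticGame

/-! ### The dice games -/

namespace DiceVariant

/-- A bound for the number of steps to the end of the game (or, when exactly 200 points are
needed, to a state with 199 banked points of player one), provided that player one always rolls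
what he needs, and player two always rolls an ace. -/
def turnSteps (v : DiceVariant) : Turn → ℕ
  | ⟨.one, α, _, τ⟩ =>
      if v = .exact ∧ α = 199 ∧ τ = 0 then 0
      else if v.maxTotal = 200 ∧ α + τ = 199 then 103
      else if τ = 0 then 3 * ((205 - (α + τ)) / 6) - 1 else 3 * ((205 - (α + τ)) / 6) + 1
  | ⟨.two, α, _, _⟩ => if v = .exact ∧ α = 199 then 0 else 3 * ((205 - α) / 6)

/-- A bound for the number of rolls in the situation of `turnSteps`. -/
def turnRolls (v : DiceVariant) : Turn → ℕ
  | ⟨.one, α, _, τ⟩ =>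
      if v = .exact ∧ α = 199 ∧ τ = 0 then 0
      else if v.maxTotal = 200 ∧ α + τ = 199 then 68
      else if τ = 0 then 2 * ((205 - (α + τ)) / 6) - 1 else 2 * ((205 - (α + τ)) / 6)
  | ⟨.two, α, _, _⟩ => if v = .exact ∧ α = 199 then 0 else 2 * ((205 - α) / 6)

end DiceVariant

namespace DiceState

variable {v : DiceVariant}

/-- The final state and, when exactly 200 points are needed, the states in which player one has
banked 199 points and does not win immediately. -/
def decided (v : DiceVariant) : Set (DiceState v)
  | .start => False
  | .final => True
  | .turn ⟨.one, α, _, τ⟩ _ => v = .exact ∧ α = 199 ∧ τ = 0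
  | .turn ⟨.two, α, _, _⟩ _ => v = .exact ∧ α = 199

@[simp] theorem start_mem_decided : DiceState.start ∈ decided v ↔ False := Iff.rfl

@[simp] theorem final_mem_decided : DiceState.final ∈ decided v ↔ True := Iff.rfl

@[simp] theorem turn_one_mem_decided {α β τ : ℕ} {hx : v.Valid ⟨.one, α, β, τ⟩} :
    DiceState.turn _ hx ∈ decided v ↔ v = .exact ∧ α = 199 ∧ τ = 0 := Iff.rfl

@[simp] theorem turn_two_mem_decided {α β τ : ℕ} {hx : v.Valid ⟨.two, α, β, τ⟩} :
    DiceState.turn _ hx ∈ decided v ↔ v = .exact ∧ α = 199 := Iff.rfl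

/-- The extension of `DiceVariant.turnSteps` to all states. -/
def steps : DiceState v → ℕ
  | .start => 103
  | .final => 0
  | .turn x _ => v.turnSteps x

/-- The extension of `DiceVariant.turnRolls` to all states. -/
def rolls : DiceState v → ℕ
  | .start => 68
  | .final => 0
  | .turn x _ => v.turnRolls x

/-- The largest values are in fact 103 and, in `rolls_le`, 68; the bounds 140 and 70 leave room. -/
theorem steps_le (s : DiceState v) : s.steps ≤ 140 := by
  rcases s with _ | _ | ⟨⟨_ | _, α, β, τ⟩, hx⟩ <;>
    simp only [steps, DiceVariant.turnSteps] <;> (try split_ifs) <;> omega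

theorem rolls_le (s : DiceState v) : s.rolls ≤ 70 := by
  rcases s with _ | _ | ⟨⟨_ | _, α, β, τ⟩, hx⟩ <;>
    simp only [rolls, DiceVariant.turnRolls] <;> (try split_ifs) <;> omega

theorem rolls_eq_zero (s : DiceState v) (hs : s ∈ decided v) : s.rolls = 0 := by
  rcases s with _ | _ | ⟨⟨_ | _, α, β, τ⟩, hx⟩ <;> simp at hs <;>
    simp [rolls, DiceVariant.turnRolls, hs]

/-! ### The rank condition for single moves -/

theorem le_lexpect_transition_turn {x : Turn} {hx : v.Valid x}
    {a : (DiceState.turn x hx).Action .one} {b : (DiceState.turn x hx).Action .two}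
    {g : DiceState v → ℝ≥0∞} {c : ℝ≥0∞}
    (h : ∀ m hm, c ≤ (moveLaw x hx m hm).lexpect g) : c ≤ (transition _ a b).lexpect g := by
  simp only [transition]
  split_ifs <;> exact h _ _

theorem le_lexpect_moveLaw {x : Turn} {hx : v.Valid x} {g : DiceState v → ℝ≥0∞} {c : ℝ≥0∞}
    (hroll : x.total < 200 → c ≤ ((PMF.uniformOfFintype (Fin 6)).map (afterRoll x hx)).lexpect g)
    (hhold : ∀ hs, c ≤ g (afterStop x hx hs)) (m : Move) (hm : v.Legal x m) :
    c ≤ (moveLaw x hx m hm).lexpect g := by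
  cases m with
  | roll => exact hroll hm
  | hold => simpa [moveLaw] using hhold hm
  | wait => exact hm.elim

theorem le_lexpect_roll {x : Turn} {hx : v.Valid x} {g : DiceState v → ℝ≥0∞} {c : ℝ≥0∞}
    (h : ∀ d, c ≤ g (afterRoll x hx d)) :
    c ≤ ((PMF.uniformOfFintype (Fin 6)).map (afterRoll x hx)).lexpect g := by
  rw [PMF.lexpect_map, ← PMF.lexpect_const (PMF.uniformOfFintype (Fin 6)) c]
  exact PMF.lexpect_mono _ h

/-- The weight that a state contributes in `StochasticGame.IsRank.step`. -/
noncomputable def weight (n : ℕ) (s : DiceState v) : ℝ≥0∞ :=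
  if s.steps < n then (6 : ℝ≥0∞)⁻¹ ^ s.rolls else 0

theorem pow_le_weight {n r : ℕ} {s : DiceState v} (hs : s.steps < n) (hr : s.rolls ≤ r) :
    (6 : ℝ≥0∞)⁻¹ ^ r ≤ s.weight n := by
  rw [weight, if_pos hs]
  exact pow_le_pow_of_le_one zero_le (by simp) hr

theorem pow_le_lexpect_roll {x : Turn} {hx : v.Valid x} {n r : ℕ} (d : Fin 6)
    (hs : (afterRoll x hx d).steps < n) (hr : (afterRoll x hx d).rolls + 1 ≤ r) :
    (6 : ℝ≥0∞)⁻¹ ^ r ≤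
      ((PMF.uniformOfFintype (Fin 6)).map (afterRoll x hx)).lexpect (weight n) := by
  rw [PMF.lexpect_map]
  refine le_trans ?_ (PMF.mul_le_lexpect _ _ d)
  rw [PMF.uniformOfFintype_apply, Fintype.card_fin, weight, if_pos hs]
  calc (6 : ℝ≥0∞)⁻¹ ^ r ≤ 6⁻¹ ^ ((afterRoll x hx d).rolls + 1) :=
        pow_le_pow_of_le_one zero_le (by simp) hr
    _ = _ := by rw [pow_succ']; norm_num

theorem afterRoll_ace (x : Turn) (hx : v.Valid x) :
    afterRoll x hx 0 = .turn x.pass (valid_pass hx) := by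
  simp [afterRoll]

/-- Player one can get closer to the target with a suitable number. -/
theorem exists_favourable_face {α β τ : ℕ} (hx : v.Valid ⟨.one, α, β, τ⟩) (ht : α + τ < 200)
    (h : ¬(v.maxTotal = 200 ∧ α + τ = 199)) :
    ∃ d : Fin 6, (afterRoll _ hx d).steps = 3 * ((205 - (α + τ)) / 6) - 2 ∧
      (afterRoll _ hx d).rolls = 2 * ((205 - (α + τ)) / 6) - 2 := by
  obtain ⟨d, h0, h1, h2, h3⟩ : ∃ d : Fin 6, d ≠ 0 ∧ α + τ + (d + 1) ≤ v.maxTotal ∧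
      ¬(v.maxTotal = 200 ∧ α + τ + (d + 1) = 199) ∧
      (205 - (α + (τ + (d + 1)))) / 6 + 1 = (205 - (α + τ)) / 6 := by
    -- A six always lowers the distance by one unit of six points. When exactly 200 points are
    -- needed, the total 199 and overshooting must be avoided: from 193 a five leads to 198, and
    -- from 194 to 198 the exact difference, a number from 2 to 6, leads to 200.
    by_cases hv : v.maxTotal = 200
    · by_cases h8 : α + τ ≤ 192
      · exact ⟨5, by decide, by simp; omega, by simp; omega, by simp; omega⟩
      · by_cases h7 : α + τ = 193
        · exact ⟨4, by decide, by simp; omega, by simp; omega, by simp; omega⟩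
        · refine ⟨⟨199 - (α + τ), by omega⟩, ?_, ?_, ?_, ?_⟩
          · simp [Fin.ext_iff]; omega
          all_goals simp only; omega
    · have hv' : v.maxTotal = 205 := by cases v <;> simp [DiceVariant.maxTotal] at hv ⊢
      exact ⟨5, by decide, by simp; omega, by simp; omega, by simp; omega⟩
  refine ⟨d, ?_⟩
  rw [afterRoll, dif_neg (by simp only [Turn.total]; omega)]
  have h4 : ¬(v.maxTotal = 200 ∧ α + (τ + (d + 1)) = 199) := by omega
  simp only [Turn.add, steps, rolls, DiceVariant.turnSteps, DiceVariant.turnRolls, h4, if_false,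
    Nat.add_eq_zero_iff, one_ne_zero, and_false]
  omega

/-- Player one, with 199 banked points and an empty turn score, must roll, and every number loses
the turn: an ace by rule, the others by exceeding 200. Moves of player two do not change `α`. -/
theorem one_le_lexpect_transition (s : DiceState v) (hs : s ∈ decided v) (a : s.Action .one)
    (b : s.Action .two) : 1 ≤ (transition s a b).lexpect ((decided v).indicator 1) := by
  classical
  rcases s with _ | _ | ⟨⟨_ | _, α, β, τ⟩, hx⟩
  · exact hs.elim
  · simp [transition]
  · obtain ⟨rfl, rfl, rfl⟩ := turn_one_mem_decided.1 hs
    refine le_lexpect_transition_turn (le_lexpect_moveLaw (fun _ => le_lexpect_roll fun d => ?_)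
      fun hs => absurd hs.1 (lt_irrefl _))
    have : afterRoll _ hx d ∈ decided .exact := by
      rw [afterRoll, dif_pos]
      · simp [Turn.pass]
      · by_cases hd : d = 0
        · exact Or.inl hd
        · right
          have := Fin.val_ne_zero_iff.2 hd
          simp [DiceVariant.maxTotal, Turn.total]
          omega
    rw [Set.indicator_of_mem this, Pi.one_apply]
  · obtain ⟨rfl, rfl⟩ := turn_two_mem_decided.1 hs
    refine le_lexpect_transition_turn (le_lexpect_moveLaw (fun _ => le_lexpect_roll fun d => ?_)
      fun hs => ?_)
    · have : afterRoll _ hx d ∈ decided .exact := by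
        rw [afterRoll]
        split_ifs <;> simp [Turn.pass, Turn.add]
      rw [Set.indicator_of_mem this, Pi.one_apply]
    · have : afterStop _ hx hs ∈ decided .exact := by
        rw [afterStop]
        split_ifs <;> simp [Turn.bank]
      rw [Set.indicator_of_mem this, Pi.one_apply]

theorem pow_rolls_le (s : DiceState v) (hs : s ∉ decided v) (a : s.Action .one)
    (b : s.Action .two) : (6 : ℝ≥0∞)⁻¹ ^ s.rolls ≤ (transition s a b).lexpect (weight s.steps) := by
  rcases s with _ | _ | ⟨⟨_ | _, α, β, τ⟩, hx⟩
  -- The worse successor is `(2, 0, 0, 0)`, with `3 * 34 = 102` steps and `2 * 34 = 68` rolls.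
  · change (6 : ℝ≥0∞)⁻¹ ^ 68 ≤ ((PMF.uniformOfFintype Player).map fun j =>
      DiceState.turn ⟨j, 0, 0, 0⟩ (valid_zero j)).lexpect (weight 103)
    rw [PMF.lexpect_map, ← PMF.lexpect_const (PMF.uniformOfFintype Player) ((6 : ℝ≥0∞)⁻¹ ^ 68)]
    refine PMF.lexpect_mono _ fun j => pow_le_weight ?_ ?_ <;>
      cases j <;> simp [steps, rolls, DiceVariant.turnSteps, DiceVariant.turnRolls]
  · exact absurd trivial hs
  · rw [turn_one_mem_decided] at hs
    refine le_lexpect_transition_turn (g := weight _)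
      (le_lexpect_moveLaw (fun ht => ?_) fun hl => ?_)
    · have ht : α + τ < 200 := ht
      -- At the total 199 every roll loses the turn and leaves player two with the die and `α`
      -- unchanged. The ranks 103 and 68 cover the worst such state, `α = 0`, with 102 steps and 68
      -- rolls.
      by_cases h1 : v.maxTotal = 200 ∧ α + τ = 199
      · refine le_lexpect_roll fun d => ?_
        rw [afterRoll, dif_pos (by
          by_cases hd : d = 0
          · exact Or.inl hd
          · right
            have := Fin.val_ne_zero_iff.2 hd
            simp only [Turn.total]
            omega)]
        apply pow_le_weight <;>
          simp only [Turn.pass, steps, rolls, DiceVariant.turnSteps, DiceVariant.turnRolls, hs, h1] <;>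
          simp <;> split_ifs <;> omega
      · obtain ⟨d, hd1, hd2⟩ := exists_favourable_face hx ht h1
        refine pow_le_lexpect_roll d ?_ ?_
        · rw [hd1]
          simp only [steps, DiceVariant.turnSteps, hs, h1, if_false]
          split_ifs <;> omega
        · rw [hd2]
          simp only [rolls, DiceVariant.turnRolls, hs, h1, if_false]
          split_ifs <;> omega
    · have hτ : τ ≠ 0 := hl.1.ne'
      rw [afterStop]
      split_ifs with ht
      · have ht : α + τ < 200 := ht
        apply pow_le_weight <;>
          simp only [Turn.bank, steps, rolls, DiceVariant.turnSteps, DiceVariant.turnRolls, and_false,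
            if_false, hτ] <;> split_ifs <;> omega
      · have ht : ¬α + τ < 200 := ht
        apply pow_le_weight <;>
          simp only [steps, rolls, DiceVariant.turnSteps, DiceVariant.turnRolls, and_false, if_false, hτ] <;>
          split_ifs <;> omega
  · rw [turn_two_mem_decided] at hs
    have hα : α < 200 := by
      have := hx.1
      cases v <;> simp [DiceVariant.maxScore] at this <;> omega
    -- Here the exclusion of a banked 199 enters: it is either forbidden or already decided.
    -- Otherwise passing the die to player one would raise the rank to 103.
    have h1 : ¬(v.maxTotal = 200 ∧ α = 199) := by
      have := hx.1
      cases v <;> simp [DiceVariant.maxScore, DiceVariant.maxTotal] at this hs ⊢ <;> omega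
    refine le_lexpect_transition_turn (g := weight _)
      (le_lexpect_moveLaw (fun ht => ?_) fun hl => ?_)
    · refine pow_le_lexpect_roll 0 ?_ ?_ <;> rw [afterRoll_ace] <;>
        simp only [Turn.pass, steps, rolls, DiceVariant.turnSteps, DiceVariant.turnRolls, hs, and_true,
          Nat.add_zero, h1, if_false, if_true] <;> omega
    · rw [afterStop]
      split_ifs with ht <;> apply pow_le_weight <;>
        simp only [Turn.bank, steps, rolls, DiceVariant.turnSteps, DiceVariant.turnRolls, hs, and_true,
          Nat.add_zero, h1, if_false, if_true] <;> omega

theorem isRank (v : DiceVariant) :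
    StochasticGame.IsRank (G := diceGame v) (decided v) steps rolls :=
  ⟨one_le_lexpect_transition, rolls_eq_zero, pow_rolls_le⟩

theorem payoff_of_mem_decided {s : DiceState v} (hs : s ∈ decided v) : s.payoff = 0 := by
  rcases s with _ | _ | ⟨⟨_ | _, α, β, τ⟩, hx⟩ <;> simp at hs
  · rfl
  · obtain ⟨rfl, rfl, rfl⟩ := hs
    simp [payoff]
  · obtain ⟨rfl, rfl⟩ := hs
    simp [payoff]

theorem decided_eq_singleton (hv : v ≠ .exact) : decided v = {DiceState.final} := by
  ext s
  rcases s with _ | _ | ⟨⟨_ | _, α, β, τ⟩, hx⟩ <;> simp [hv]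

theorem isRank_final (hv : v ≠ .exact) :
    StochasticGame.IsRank (G := diceGame v) {DiceState.final} steps rolls := by
  have := isRank v
  rwa [decided_eq_singleton hv] at this

theorem isPerfectInformation (v : DiceVariant) : (diceGame v).IsPerfectInformation := by
  rintro (_ | _ | ⟨x, hx⟩)
  · exact Or.inl ⟨fun a b => Subtype.ext (a.2.trans b.2.symm)⟩
  · exact Or.inl ⟨fun a b => Subtype.ext (a.2.trans b.2.symm)⟩
  · by_cases hj : x.j = .one
    · have h (a : (DiceState.turn x hx).Action .two) : a.1 = .wait := by
        simpa [Allowed, hj] using a.2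
      exact Or.inr ⟨fun a b => Subtype.ext ((h a).trans (h b).symm)⟩
    · have h (a : (DiceState.turn x hx).Action .one) : a.1 = .wait := by
        simpa [Allowed, hj] using a.2
      exact Or.inl ⟨fun a b => Subtype.ext ((h a).trans (h b).symm)⟩

theorem exists_isPotential (v : DiceVariant) : ∃ w : (diceGame v).S → ℝ,
    StochasticGame.IsPotential w ∧ ∀ s, w s = 0 ↔ s ∈ decided v :=
  (isRank v).exists_isPotential fun _ hs _ _ => payoff_of_mem_decided hs

theorem exists_isPotential_final (hv : v ≠ .exact) : ∃ w : (diceGame v).S → ℝ,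
    StochasticGame.IsPotential w ∧ ∀ s, w s = 0 ↔ s = DiceState.final :=
  (isRank_final hv).exists_isPotential fun s hs _ _ => by
    obtain rfl : s = DiceState.final := hs
    rfl

end DiceState

/-! ### The main theorem -/

theorem mainTheorem1 :
    (∀ v ∈ ({DiceVariant.classic, DiceVariant.difference, DiceVariant.exactNo199} :
        Set DiceVariant),
      (∀ (π : (diceGame v).Strategy₁) (φ : (diceGame v).Strategy₂) (h : (diceGame v).History),
        ((6 : ℝ≥0∞)⁻¹) ^ 70 ≤ StochasticGame.stateLawFrom π φ h 140 DiceState.final) ∧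
      (∀ (π : (diceGame v).Strategy₁) (φ : (diceGame v).Strategy₂) (s : (diceGame v).S) (t : ℕ),
        StochasticGame.probNe π φ s t DiceState.final ≤ (1 - ((6 : ℝ≥0∞)⁻¹) ^ 70) ^ (t / 140)) ∧
      (diceGame v).IsTransientWith DiceState.final ∧
      (∀ (π : (diceGame v).Strategy₁) (φ : (diceGame v).Strategy₂) (s : (diceGame v).S),
        Summable fun t => StochasticGame.expectedPay π φ s t) ∧
      ∃ val : (diceGame v).S → ℝ,
        (∀ s, (diceGame v).lowerValue s = val s ∧ (diceGame v).upperValue s = val s) ∧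
        (∀ x : (diceGame v).S → ℝ, x DiceState.final = 0 ∧ (diceGame v).U x = x ↔ x = val) ∧
        (∀ σ : (s : (diceGame v).S) → PMF ((diceGame v).A s),
          (∀ s q, matrixValue ((diceGame v).auxMatrix val s) ≤
            matrixPay ((diceGame v).auxMatrix val s) (σ s) q) →
            StochasticGame.IsOptimal₁ (StochasticGame.stationary₁ σ)) ∧
        (∀ σ : (s : (diceGame v).S) → PMF ((diceGame v).B s),
          (∀ s p, matrixPay ((diceGame v).auxMatrix val s) p (σ s) ≤
            matrixValue ((diceGame v).auxMatrix val s)) →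
            StochasticGame.IsOptimal₂ (StochasticGame.stationary₂ σ)) ∧
        (∃ π : (diceGame v).Strategy₁,
          StochasticGame.IsPure₁ π ∧ StochasticGame.IsStationary₁ π ∧ StochasticGame.IsOptimal₁ π) ∧
        (∃ φ : (diceGame v).Strategy₂,
          StochasticGame.IsPure₂ φ ∧ StochasticGame.IsStationary₂ φ ∧ StochasticGame.IsOptimal₂ φ)) ∧
    ((∀ (π : (diceGame .exact).Strategy₁) (φ : (diceGame .exact).Strategy₂)
        (s : (diceGame .exact).S), Summable fun t => StochasticGame.expectedPay π φ s t) ∧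
      ∃ val : (diceGame .exact).S → ℝ,
        (∀ s, (diceGame .exact).lowerValue s = val s ∧ (diceGame .exact).upperValue s = val s) ∧
        (diceGame .exact).U val = val ∧
        (∃ π : (diceGame .exact).Strategy₁,
          StochasticGame.IsPure₁ π ∧ StochasticGame.IsStationary₁ π ∧ StochasticGame.IsOptimal₁ π) ∧
        (∃ φ : (diceGame .exact).Strategy₂,
          StochasticGame.IsPure₂ φ ∧ StochasticGame.IsStationary₂ φ ∧ StochasticGame.IsOptimal₂ φ)) := by
  constructor
  · intro v hv
    have hv' : v ≠ .exact := by
      rintro rfl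
      simp at hv
    have hF := DiceState.isRank_final hv'
    obtain ⟨w, hw, hwF⟩ := DiceState.exists_isPotential_final hv'
    have hG := DiceState.isPerfectInformation v
    obtain ⟨val, hval, hU⟩ := hw.exists_fixed_point hG
    refine ⟨hF.pow_le_stateLawFrom DiceState.steps_le DiceState.rolls_le,
      hF.probNe_le DiceState.steps_le DiceState.rolls_le, ⟨fun _ _ => rfl, fun _ _ => ?_,
      hw.tsum_probNe_lt_top hwF⟩, hw.summable_expectedPay, val, hw.value_eq hG hval hU,
      fun x => ⟨fun ⟨hx, hUx⟩ => ?_, ?_⟩, fun σ => hw.isOptimal₁_stationary₁ hG hval hU,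
      fun σ => hw.isOptimal₂_stationary₂ hG hval hU, hw.exists_pure_stationary_optimal₁ hG hval hU,
      hw.exists_pure_stationary_optimal₂ hG hval hU⟩
    · exact (PMF.pure_apply _ _).trans (if_pos rfl)
    · funext s
      -- As `w` vanishes only at the final state, `x` vanishes wherever `w` does, so `x` is the
      -- value too. In the game `exact` the zero set of `w` is larger, and this argument would not
      -- apply.
      have h1 := (hw.value_eq hG (fun s hs => by rw [(hwF s).1 hs, hx]) hUx s).1
      exact EReal.coe_injective (h1.symm.trans (hw.value_eq hG hval hU s).1)
    · rintro rfl
      exact ⟨hval _ ((hwF _).2 rfl), hU⟩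
  · obtain ⟨w, hw, -⟩ := DiceState.exists_isPotential .exact
    have hG := DiceState.isPerfectInformation .exact
    obtain ⟨val, hval, hU⟩ := hw.exists_fixed_point hG
    exact ⟨hw.summable_expectedPay, val, hw.value_eq hG hval hU, hU,
      hw.exists_pure_stationary_optimal₁ hG hval hU, hw.exists_pure_stationary_optimal₂ hG hval hU⟩
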